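/- Let $p,p'\ge 0$ be integers, let $\mathcal M$ be a smooth manifold of dimension $n=p+p'$, and for $x\in\mathcal M$ let $\Gamma_x$ be the space of all scalar products (non-degenerate symmetric bilinear forms) of signature $(p,p')$ on $T_x\mathcal M$, with its topology as a subset of the finite-dimensional space of symmetric bilinear forms. The group $GL(T_x\mathcal M)$ acts on $\Gamma_x$ by $g\gamma=(g^{-1})^*\gamma$. A \emph{diffeomorphism invariant field of invariant measures} is a field $x\mapsto\mu_x$ of measures on the spaces $\Gamma_x$ for which there are a point $x_0\in\mathcal M$ and a non-zero $GL(T_{x_0}\mathcal M)$-invariant regular Borel measure $\mu_{x_0}$ on $\Gamma_{x_0}$ such that, for every $x$, $\mu_x$ is the push-forward of $\mu_{x_0}$ under the pull-back $l_x^*:\Gamma_{x_0}\to\Gamma_x$ along a linear isomorphism $l_x:T_x\mathcal M\to T_{x_0}\mathcal M$. Given such a field, put $\mathcal H_x=L^2(\Gamma_x,\mu_x)$ and, for every finite subset $\lambda\subset\mathcal M$, let $\mathcal H_\lambda=\bigotimes_{x\in\lambda}\mathcal H_x$ (Hilbert space tensor product), let $\mathcal B_\lambda$ be the $C^*$-algebra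 of bounded operators on $\mathcal H_\lambda$ and $\mathcal S_\lambda$ the set of states (positive linear functionals of norm one) on $\mathcal B_\lambda$. For $\lambda\subset\lambda'$ identify $\mathcal H_{\lambda'}=\mathcal H_{\lambda'\setminus\lambda}\otimes\mathcal H_\lambda$ and put $\iota_{\lambda'\lambda}(a)=\mathbf 1\otimes a$ for $a\in\mathcal B_\lambda$. Let $\mathcal B$ be the inductive limit $C^*$-algebra of the family $(\mathcal B_\lambda,\iota_{\lambda'\lambda})$, with canonical maps $j_\lambda:\mathcal B_\lambda\to\mathcal B$, and let $\mathcal S$ be the projective limit of the family $(\mathcal S_\lambda,\iota_{\lambda'\lambda}^*)$; it consists of the families $s=(s_\lambda)$ of states $s_\lambda\in\mathcal S_\lambda$ with $s_{\lambda'}\circ\iota_{\lambda'\lambda}=s_\lambda$ and carries the topology induced from the weak-$*$ topologies. Each $s\in\mathcal S$ defines a state on $\mathcal B$, again denoted by $s$, with $s(j_\lambda(a))=s_\lambda(a)$. Let $x\mapsto\mu_x$ and $x\mapsto\check\mu_x$ be two diffeomorphism invariant fields of invariant measures, and let the objects built from the second field be marked by a check. Then: 1. There is exactly one constant $c>0$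 such that $\check\mu_x=c\,\mu_x$ for all $x\in\mathcal M$. 2. There is exactly one family of Hilbert space isomorphisms $U_\lambda:\mathcal H_\lambda\to\check{\mathcal H}_\lambda$, $\lambda\subset\mathcal M$ finite, given by $U_\lambda\Psi=c^{-\#\lambda/2}\,\Psi$, i.e. such that $U_\lambda\big(\bigotimes_{x\in\lambda}f_x\big)=c^{-\#\lambda/2}\bigotimes_{x\in\lambda}f_x$ for all square integrable functions $f_x$ on $\Gamma_x$. It satisfies $U_{\lambda'}=U_{\lambda'\setminus\lambda}\otimes U_\lambda$ for $\lambda\subset\lambda'$. 3. The $C^*$-algebra isomorphisms $u_\lambda:\mathcal B_\lambda\to\check{\mathcal B}_\lambda$, $u_\lambda(a)=U_\lambda aU_\lambda^{-1}$, satisfy $\check\iota_{\lambda'\lambda}\circ u_\lambda=u_{\lambda'}\circ\iota_{\lambda'\lambda}$ for $\lambda\subset\lambda'$, and there is exactly one $*$-isomorphism $\mathcal U:\mathcal B\to\check{\mathcal B}$ with $\mathcal U\circ j_\lambda=\check j_\lambda\circ u_\lambda$ for all $\lambda$. 4. There is exactly one homeomorphism $\mathcal U^*:\check{\mathcal S}\to\mathcal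 S$ with $(\mathcal U^*\check s)_\lambda=\check s_\lambda\circ u_\lambda$ for all $\lambda$ and $\check s\in\check{\mathcal S}$; it preserves convex combinations, and $$(\mathcal U^*\check s)(a)=\check s(\mathcal U(a))\qquad\text{for all }\check s\in\check{\mathcal S},\ a\in\mathcal B.$$ -/

import Mathlib

open scoped TensorProduct ComplexOrder

set_option linter.unusedSectionVars false

noncomputable section

namespace Kijowski

/-! ## Hilbert space tensor products -/

section HilbertTensor

variable {ι : Type*} [Fintype ι] (E : ι → Type*)
  [∀ i, NormedAddCommGroup (E i)] [∀ i, InnerProductSpace ℂ (E i)]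

/-- The algebraic tensor product of a finite family of inner product spaces. It is a type synonym,
to be equipped with the inner product below instead of Mathlib's projective seminorm. -/
def AlgTensor : Type _ := PiTensorProduct ℂ E

namespace AlgTensor

instance : AddCommGroup (AlgTensor E) := inferInstanceAs (AddCommGroup (PiTensorProduct ℂ E))
instance : Module ℂ (AlgTensor E) := inferInstanceAs (Module ℂ (PiTensorProduct ℂ E))

variable {E}

/-- Elementary tensors. -/
def tprod (f : ∀ i, E i) : AlgTensor E := PiTensorProduct.tprod ℂ f

theorem span_tprod : Submodule.span ℂ (Set.range (tprod (E := E))) = ⊤ :=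
  PiTensorProduct.span_tprod_eq_top

/-- The linear functional `x ↦ ∏ i, ⟪f i, x i⟫`. -/
def innerFun (f : ∀ i, E i) : AlgTensor E →ₗ[ℂ] ℂ :=
  PiTensorProduct.lift ((MultilinearMap.mkPiAlgebra ℂ ι ℂ).compLinearMap
    fun i => (innerSL ℂ (f i) : E i →L[ℂ] ℂ).toLinearMap)

theorem innerFun_tprod (f g : ∀ i, E i) : innerFun f (tprod g) = ∏ i, inner ℂ (f i) (g i) := by
  refine (PiTensorProduct.lift.tprod g).trans ?_
  simp

theorem linearMap_ext {σ : ℂ →+* ℂ} {P : Type*} [AddCommGroup P] [Module ℂ P]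
    {L L' : AlgTensor E →ₛₗ[σ] P} (h : ∀ f, L (tprod f) = L' (tprod f)) : L = L' :=
  LinearMap.ext_on_range span_tprod h

/-- The conjugate-linear functional `x ↦ ∏ i, ⟪x i, f i⟫`. -/
def innerFunConj (f : ∀ i, E i) : AlgTensor E →ₛₗ[starRingEnd ℂ] ℂ where
  toFun x := starRingEnd ℂ (innerFun f x)
  map_add' x y := by simp
  map_smul' c x := by simp

theorem innerFunConj_tprod (f g : ∀ i, E i) :
    innerFunConj f (tprod g) = ∏ i, inner ℂ (g i) (f i) := by
  simp [innerFunConj, innerFun_tprod]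

/-- The sesquilinear form with `⟪⊗ f i, ⊗ g i⟫ = ∏ i, ⟪f i, g i⟫`, as a map linear in the
second argument. -/
def innerForm : AlgTensor E →ₗ[ℂ] AlgTensor E →ₛₗ[starRingEnd ℂ] ℂ :=
  PiTensorProduct.lift (R := ℂ) (s := E)
    { toFun := innerFunConj
      map_update_add' := by
        intro _ f i x y
        refine linearMap_ext fun g => ?_
        simp only [LinearMap.add_apply, innerFunConj_tprod]
        simp only [← Finset.mul_prod_erase _ _ (Finset.mem_univ i), Function.update_self,
          inner_add_right, add_mul]
        congr 2 <;> refine Finset.prod_congr rfl fun j hj => ?_ <;>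
          simp [Function.update_of_ne (Finset.ne_of_mem_erase hj)]
      map_update_smul' := by
        intro _ f i c x
        refine linearMap_ext fun g => ?_
        simp only [LinearMap.smul_apply, innerFunConj_tprod]
        simp only [← Finset.mul_prod_erase _ _ (Finset.mem_univ i), Function.update_self,
          inner_smul_right, smul_eq_mul, mul_assoc]
        congr 2
        refine Finset.prod_congr rfl fun j hj => ?_
        simp [Function.update_of_ne (Finset.ne_of_mem_erase hj)] }

theorem innerForm_tprod_left (g : ∀ i, E i) : innerForm (tprod g) = innerFunConj g :=
  PiTensorProduct.lift.tprod g

theorem innerForm_tprod (f g : ∀ i, E i) :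
    innerForm (tprod g) (tprod f) = ∏ i, inner ℂ (f i) (g i) := by
  rw [innerForm_tprod_left, innerFunConj_tprod]

theorem posSemidef_prod {κ : Type*} [Fintype κ] (s : Finset ι) (v : κ → ∀ i, E i) :
    (Matrix.of fun j k : κ => ∏ i ∈ s, inner ℂ (v j i) (v k i)).PosSemidef := by
  classical
  induction s using Finset.induction_on with
  | empty =>
    have h := Matrix.posSemidef_gram ℂ (E := ℂ) (fun _ : κ => (1 : ℂ))
    refine (congrArg Matrix.PosSemidef ?_).mpr h
    ext j k
    simp [Matrix.gram]
  | insert a s ha ih =>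
    have h := (Matrix.posSemidef_gram ℂ (fun k : κ => v k a)).hadamard ih
    refine (congrArg Matrix.PosSemidef ?_).mpr h
    ext j k
    simp [Finset.prod_insert ha, Matrix.gram]

theorem innerForm_self_nonneg (x : AlgTensor E) : 0 ≤ innerForm x x := by
  have hx : x ∈ Submodule.span ℂ (Set.range (tprod (E := E))) := by rw [span_tprod]; trivial
  obtain ⟨m, c, g, rfl⟩ := Submodule.mem_span_set'.1 hx
  choose v hv using fun j => (g j).2
  have h := (posSemidef_prod Finset.univ v).dotProduct_mulVec_nonneg c
  convert h using 1
  simp only [← hv]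
  simp [innerForm_tprod, dotProduct, Matrix.mulVec, Finset.mul_sum, LinearMap.sum_apply]
  refine Finset.sum_congr rfl fun j _ => Finset.sum_congr rfl fun k _ => ?_
  ring

/-- The pre-inner product on the algebraic tensor product. -/
abbrev preInnerCore : PreInnerProductSpace.Core ℂ (AlgTensor E) where
  inner x y := innerForm y x
  conj_inner_symm x y := by
    have : ∀ f, (starRingEnd ℂ) (innerForm x (tprod f)) = innerForm (tprod f) x := fun f => by
      rw [innerForm_tprod_left]
      simp only [innerFunConj, LinearMap.coe_mk, AddHom.coe_mk]
      congr 1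
      have : (innerForm.flip (tprod f)) = innerFun f := by
        refine linearMap_ext fun g => ?_
        simp [innerForm_tprod, innerFun_tprod]
      rw [← this]; rfl
    have hy : y ∈ Submodule.span ℂ (Set.range (tprod (E := E))) := by rw [span_tprod]; trivial
    induction hy using Submodule.span_induction with
    | mem y hy => obtain ⟨f, rfl⟩ := hy; exact this f
    | zero => simp
    | add y z _ _ hy hz => simp [hy, hz]
    | smul c y _ hy => simp [hy]
  re_inner_nonneg x := (Complex.nonneg_iff.1 (innerForm_self_nonneg x)).1
  add_left x y z := by simp
  smul_left x y c := by simp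

instance : SeminormedAddCommGroup (AlgTensor E) :=
  letI := preInnerCore (E := E)
  InnerProductSpace.Core.toSeminormedAddCommGroup (𝕜 := ℂ)

instance : InnerProductSpace ℂ (AlgTensor E) :=
  letI := preInnerCore (E := E)
  InnerProductSpace.ofCore _

theorem inner_tprod (f g : ∀ i, E i) :
    inner ℂ (tprod f) (tprod g) = ∏ i, inner ℂ (f i) (g i) :=
  innerForm_tprod f g

end AlgTensor

end HilbertTensor

section Family

open UniformSpace

variable {X : Type*} (E : X → Type*)
  [∀ x, NormedAddCommGroup (E x)] [∀ x, InnerProductSpace ℂ (E x)]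

/-- The Hilbert space tensor product of two Hilbert spaces. -/
abbrev HTensor (A B : Type*) [NormedAddCommGroup A] [InnerProductSpace ℂ A]
    [NormedAddCommGroup B] [InnerProductSpace ℂ B] : Type _ :=
  Completion (A ⊗[ℂ] B)

/-- The tensor product `a ⊗ b` of bounded operators, on the Hilbert space tensor product. -/
def HTensor.map {A B A' B' : Type*} [NormedAddCommGroup A] [InnerProductSpace ℂ A]
    [NormedAddCommGroup B] [InnerProductSpace ℂ B]
    [NormedAddCommGroup A'] [InnerProductSpace ℂ A']
    [NormedAddCommGroup B'] [InnerProductSpace ℂ B'] (a : A →L[ℂ] A') (b : B →L[ℂ] B') :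
    HTensor A B →L[ℂ] HTensor A' B' :=
  (TensorProduct.mapL a b).completion

theorem HTensor.inner_map {A B : Type*} [NormedAddCommGroup A] [InnerProductSpace ℂ A]
    [NormedAddCommGroup B] [InnerProductSpace ℂ B] [CompleteSpace A] [CompleteSpace B]
    (a : A →L[ℂ] A) (b : B →L[ℂ] B) (x y : HTensor A B) :
    inner ℂ x (HTensor.map a b y) = inner ℂ (HTensor.map (star a) (star b) x) y := by
  induction x, y using Completion.induction_on₂ with
  | hp =>
    exact isClosed_eq (continuous_fst.inner ((HTensor.map a b).continuous.comp continuous_snd))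
      (((HTensor.map (star a) (star b)).continuous.comp continuous_fst).inner continuous_snd)
  | ih x y =>
    simp only [HTensor.map, ContinuousLinearMap.completion_apply_coe, Completion.inner_coe]
    induction x using TensorProduct.induction_on with
    | zero => simp
    | add x z hx hz => rw [map_add, inner_add_left, inner_add_left, hx, hz]
    | tmul u v =>
      induction y using TensorProduct.induction_on with
      | zero => simp
      | add x z hx hz => rw [map_add, inner_add_right, inner_add_right, hx, hz]
      | tmul u' v' =>
        simp [ContinuousLinearMap.star_eq_adjoint, ContinuousLinearMap.adjoint_inner_left]

/-- The Hilbert space `⨂ x ∈ s, E x`. -/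
abbrev TSpace (s : Finset X) : Type _ := Completion (AlgTensor fun x : s => E x)

variable {E}

/-- The elementary tensor `⨂ x ∈ s, f x` in the Hilbert space tensor product. -/
def elem (s : Finset X) (f : ∀ x, E x) : TSpace E s :=
  ((AlgTensor.tprod fun x : s => f x : AlgTensor fun x : s => E x) : TSpace E s)

theorem inner_elem (s : Finset X) (f g : ∀ x, E x) :
    inner ℂ (elem s f) (elem s g) = ∏ x ∈ s, inner ℂ (f x) (g x) := by
  rw [elem, elem, Completion.inner_coe, AlgTensor.inner_tprod]
  exact Finset.prod_coe_sort s fun x => inner ℂ (f x) (g x)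

theorem elem_congr {s : Finset X} {f g : ∀ x, E x} (h : ∀ x ∈ s, f x = g x) :
    elem s f = elem s g := by
  rw [elem, elem, funext fun x : s => h x x.2]

open Classical in
theorem tprod_eq_elem {s : Finset X} (f : ∀ x : s, E x) :
    ((AlgTensor.tprod f : AlgTensor fun x : s => E x) : TSpace E s) =
      elem s fun x => if h : x ∈ s then f ⟨x, h⟩ else 0 := by
  rw [elem]
  congr 2
  ext x
  simp

theorem closed_eq_top {s : Finset X} (K : Submodule ℂ (TSpace E s))
    (hK : IsClosed (K : Set (TSpace E s))) (h : ∀ f, elem s f ∈ K) (x : TSpace E s) : x ∈ K := by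
  induction x using Completion.induction_on with
  | hp => exact hK
  | ih x =>
    have hx : x ∈ Submodule.span ℂ (Set.range (AlgTensor.tprod (E := fun x : s => E x))) := by
      rw [AlgTensor.span_tprod]; trivial
    induction hx using Submodule.span_induction with
    | mem y hy => obtain ⟨f, rfl⟩ := hy; rw [tprod_eq_elem]; exact h _
    | zero => rw [Completion.coe_zero]; exact K.zero_mem
    | add y z _ _ hy hz => rw [Completion.coe_add]; exact K.add_mem hy hz
    | smul c y _ hy => rw [Completion.coe_smul]; exact K.smul_mem c hy

/-- Continuous linear maps which agree on elementary tensors are equal. -/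
theorem ext_elem {s : Finset X} {P : Type*} [NormedAddCommGroup P] [NormedSpace ℂ P]
    {L L' : TSpace E s →L[ℂ] P} (h : ∀ f, L (elem s f) = L' (elem s f)) : L = L' := by
  ext x
  exact closed_eq_top (LinearMap.eqLocus (L : TSpace E s →ₗ[ℂ] P) L')
    (isClosed_eq L.continuous L'.continuous) h x

section Phi

open Classical in
/-- A set is the disjoint union of a complement and a subset. -/
def splitEquiv {s t : Finset X} (h : s ⊆ t) : t ≃ (t \ s : Finset X) ⊕ s where
  toFun x := if hx : (x : X) ∈ s then .inr ⟨x, hx⟩ else .inl ⟨x, Finset.mem_sdiff.2 ⟨x.2, hx⟩⟩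
  invFun := Sum.elim (fun x => ⟨x, (Finset.mem_sdiff.1 x.2).1⟩) (fun x => ⟨x, h x.2⟩)
  left_inv x := by
    by_cases hx : (x : X) ∈ s <;> simp [hx]
  right_inv y := by
    rcases y with ⟨x, hx⟩ | ⟨x, hx⟩
    · simp [(Finset.mem_sdiff.1 hx).2]
    · simp [hx]

open Classical in
/-- The linear map `⨂ x ∈ t, f x ↦ (⨂ x ∈ t \ s, f x) ⊗ (⨂ x ∈ s, f x)` between algebraic tensor
products. -/
def splitAlg {s t : Finset X} (h : s ⊆ t) : (AlgTensor fun x : t => E x) →ₗ[ℂ]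
    (AlgTensor fun x : (t \ s : Finset X) => E x) ⊗[ℂ] (AlgTensor fun x : s => E x) :=
  ((PiTensorProduct.reindex ℂ (fun x : t => E x) (splitEquiv h)).trans
    (PiTensorProduct.tmulEquivDep ℂ fun j => E ((splitEquiv h).symm j)).symm).toLinearMap

open Classical in
theorem splitAlg_tprod {s t : Finset X} (h : s ⊆ t) (f : ∀ x, E x) :
    splitAlg h (AlgTensor.tprod fun x : t => f x) =
      AlgTensor.tprod (fun x : (t \ s : Finset X) => f x) ⊗ₜ[ℂ]
        AlgTensor.tprod (fun x : s => f x) :=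
  (congrArg (PiTensorProduct.tmulEquivDep ℂ fun j => E ((splitEquiv h).symm j)).symm
    (PiTensorProduct.reindex_tprod (splitEquiv h) fun x : t => f x)).trans
      (PiTensorProduct.tmulEquivDep_symm_apply ℂ (fun j => E ((splitEquiv h).symm j))
        fun j => f ((splitEquiv h).symm j))

open Classical in
/-- The map `splitAlg`, with values in the Hilbert space tensor product. -/
def PhiAlg {s t : Finset X} (h : s ⊆ t) :
    (AlgTensor fun x : t => E x) →ₗ[ℂ] HTensor (TSpace E (t \ s)) (TSpace E s) :=
  (Completion.toComplL (𝕜 := ℂ)).toLinearMap ∘ₗ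
  TensorProduct.map
    (Completion.toComplL (𝕜 := ℂ) (E := AlgTensor fun x : (t \ s : Finset X) => E x)).toLinearMap
    (Completion.toComplL (𝕜 := ℂ) (E := AlgTensor fun x : s => E x)).toLinearMap ∘ₗ
  splitAlg h

open Classical in
theorem PhiAlg_tprod {s t : Finset X} (h : s ⊆ t) (f : ∀ x, E x) :
    PhiAlg h (AlgTensor.tprod fun x : t => f x) =
      ((elem (t \ s) f ⊗ₜ[ℂ] elem s f : TSpace E (t \ s) ⊗[ℂ] TSpace E s) :
        HTensor (TSpace E (t \ s)) (TSpace E s)) := by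
  rw [PhiAlg, LinearMap.comp_apply, LinearMap.comp_apply, splitAlg_tprod]
  rfl

open Classical in
theorem PhiAlg_inner {s t : Finset X} (h : s ⊆ t) (x y : AlgTensor fun x : t => E x) :
    inner ℂ (PhiAlg h x) (PhiAlg h y) = inner ℂ x y := by
  have key : ∀ f g : ∀ x : t, E x, inner ℂ (PhiAlg h (AlgTensor.tprod f))
      (PhiAlg h (AlgTensor.tprod g)) = inner ℂ (AlgTensor.tprod f) (AlgTensor.tprod g) := by
    intro f g
    obtain ⟨f, rfl⟩ : ∃ f' : ∀ x, E x, (fun x : t => f' x) = f :=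
      ⟨fun x => if h : x ∈ t then f ⟨x, h⟩ else 0, by ext x; simp⟩
    obtain ⟨g, rfl⟩ : ∃ f' : ∀ x, E x, (fun x : t => f' x) = g :=
      ⟨fun x => if h : x ∈ t then g ⟨x, h⟩ else 0, by ext x; simp⟩
    rw [PhiAlg_tprod, PhiAlg_tprod, Completion.inner_coe, TensorProduct.inner_tmul, inner_elem,
      inner_elem, Finset.prod_sdiff h, AlgTensor.inner_tprod]
    exact (Finset.prod_coe_sort t fun x => inner ℂ (f x) (g x)).symm
  have span : ∀ z : AlgTensor fun x : t => E x,
      z ∈ Submodule.span ℂ (Set.range (AlgTensor.tprod (E := fun x : t => E x))) := fun z => by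
    rw [AlgTensor.span_tprod]; trivial
  have key2 : ∀ (f : ∀ x : t, E x) (y : AlgTensor fun x : t => E x),
      inner ℂ (PhiAlg h (AlgTensor.tprod f)) (PhiAlg h y) = inner ℂ (AlgTensor.tprod f) y := by
    intro f y
    induction span y using Submodule.span_induction with
    | mem y hy => obtain ⟨g, rfl⟩ := hy; exact key f g
    | zero => simp
    | add y z _ _ hy hz => rw [map_add, inner_add_right, inner_add_right, hy, hz]
    | smul c y _ hy => rw [map_smul, inner_smul_right, inner_smul_right, hy]
  induction span x using Submodule.span_induction with
  | mem x hx => obtain ⟨f, rfl⟩ := hx; exact key2 f y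
  | zero => simp
  | add x z _ _ hx hz => rw [map_add, inner_add_left, inner_add_left, hx, hz]
  | smul c x _ hx => rw [map_smul, inner_smul_left, inner_smul_left, hx]

theorem norm_PhiAlg {s t : Finset X} (h : s ⊆ t) (x : AlgTensor fun x : t => E x) :
    ‖PhiAlg h x‖ = ‖x‖ := by
  rw [@norm_eq_sqrt_re_inner ℂ, @norm_eq_sqrt_re_inner ℂ _ _ _ _ x, PhiAlg_inner]

open Classical in
/-- The isometric extension of `PhiAlg` to the Hilbert space tensor product. -/
def PhiIso {s t : Finset X} (h : s ⊆ t) :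
    TSpace E t →ₗᵢ[ℂ] HTensor (TSpace E (t \ s)) (TSpace E s) where
  toLinearMap := ((PhiAlg (E := E) h).mkContinuous 1
    fun x => by rw [norm_PhiAlg, one_mul]).fromCompletion.toLinearMap
  norm_map' x := by
    induction x using Completion.induction_on with
    | hp => exact isClosed_eq (ContinuousLinearMap.continuous (((PhiAlg (E := E) h).mkContinuous 1
        fun x => by rw [norm_PhiAlg, one_mul]).fromCompletion)).norm continuous_norm
    | ih x => simp [norm_PhiAlg]

open Classical in
theorem PhiIso_elem {s t : Finset X} (h : s ⊆ t) (f : ∀ x, E x) :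
    PhiIso h (elem t f) = ((elem (t \ s) f ⊗ₜ[ℂ] elem s f :
      TSpace E (t \ s) ⊗[ℂ] TSpace E s) : HTensor (TSpace E (t \ s)) (TSpace E s)) := by
  rw [← PhiAlg_tprod]
  exact ContinuousLinearMap.fromCompletion_apply_coe _ _

open Classical in
theorem PhiIso_surjective {s t : Finset X} (h : s ⊆ t) :
    Function.Surjective (PhiIso (E := E) h) := by
  intro z
  let K := LinearMap.range (PhiIso (E := E) h).toLinearMap
  have hK : IsClosed (K : Set (HTensor (TSpace E (t \ s)) (TSpace E s))) :=
    (PhiIso (E := E) h).isometry.isClosedEmbedding.isClosed_range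
  let T : TSpace E (t \ s) →L[ℂ] TSpace E s →L[ℂ] TSpace E (t \ s) ⊗[ℂ] TSpace E s :=
    TensorProduct.mkL ℂ _ _
  let J : TSpace E (t \ s) ⊗[ℂ] TSpace E s →L[ℂ] HTensor (TSpace E (t \ s)) (TSpace E s) :=
    Completion.toComplL
  have h1 : ∀ f g : ∀ x, E x, J (T (elem (t \ s) f) (elem s g)) ∈ K := by
    intro f g
    refine ⟨elem t (s.piecewise g f), ?_⟩
    change PhiIso h _ = _
    rw [PhiIso_elem, elem_congr (s := s) (g := g) fun x hx => by simp [hx],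
      elem_congr (s := t \ s) (g := f) fun x hx => by simp [(Finset.mem_sdiff.1 hx).2]]
    rfl
  have h2 : ∀ (f : ∀ x, E x) (b : TSpace E s), J (T (elem (t \ s) f) b) ∈ K := fun f b =>
    closed_eq_top (K.comap (J ∘L T (elem (t \ s) f)).toLinearMap)
      (hK.preimage (J ∘L T (elem (t \ s) f)).continuous) (h1 f) b
  have h3 : ∀ (a : TSpace E (t \ s)) (b : TSpace E s), J (T a b) ∈ K := fun a b =>
    closed_eq_top (K.comap (J ∘L T.flip b).toLinearMap)
      (hK.preimage (J ∘L T.flip b).continuous) (fun f => h2 f b) a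
  change z ∈ K
  induction z using Completion.induction_on with
  | hp => exact hK
  | ih z =>
    induction z using TensorProduct.induction_on with
    | zero => rw [Completion.coe_zero]; exact K.zero_mem
    | tmul a b => exact h3 a b
    | add y z hy hz => rw [Completion.coe_add]; exact K.add_mem hy hz

open Classical in
/-- The canonical isomorphism `⨂ x ∈ t, E x ≃ (⨂ x ∈ t \ s, E x) ⊗ (⨂ x ∈ s, E x)`, for `s ⊆ t`;
on elementary tensors it is
`⨂ x ∈ t, f x ↦ (⨂ x ∈ t \ s, f x) ⊗ (⨂ x ∈ s, f x)`, see `Phi_elem`. -/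
def Phi {s t : Finset X} (h : s ⊆ t) :
    TSpace E t ≃ₗᵢ[ℂ] HTensor (TSpace E (t \ s)) (TSpace E s) :=
  LinearIsometryEquiv.ofSurjective (PhiIso h) (PhiIso_surjective h)

open Classical in
theorem Phi_elem {s t : Finset X} (h : s ⊆ t) (f : ∀ x, E x) :
    Phi h (elem t f) = ((elem (t \ s) f ⊗ₜ[ℂ] elem s f :
      TSpace E (t \ s) ⊗[ℂ] TSpace E s) : HTensor (TSpace E (t \ s)) (TSpace E s)) :=
  PhiIso_elem h f

open Classical in
/-- The operator `b ↦ (⨂ x ∈ t \ s, f x) ⊗ b`. -/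
def tensorLeft {s t : Finset X} (h : s ⊆ t) (f : ∀ x, E x) : TSpace E s →L[ℂ] TSpace E t :=
  (Phi h).symm.toContinuousLinearEquiv.toContinuousLinearMap ∘L Completion.toComplL ∘L
    TensorProduct.mkL ℂ (TSpace E (t \ s)) (TSpace E s) (elem (t \ s) f)

open Classical in
theorem Phi_tensorLeft {s t : Finset X} (h : s ⊆ t) (f : ∀ x, E x) (b : TSpace E s) :
    Phi h (tensorLeft h f b) = ((elem (t \ s) f ⊗ₜ[ℂ] b :
      TSpace E (t \ s) ⊗[ℂ] TSpace E s) : HTensor (TSpace E (t \ s)) (TSpace E s)) := by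
  simp [tensorLeft]

open Classical in
theorem tensorLeft_elem {s t : Finset X} (h : s ⊆ t) (f g : ∀ x, E x) :
    tensorLeft h f (elem s g) = elem t (s.piecewise g f) := by
  apply (Phi h).injective
  rw [Phi_tensorLeft, Phi_elem, elem_congr (s := s) (f := s.piecewise g f) (g := g)
      fun x hx => by simp [hx], elem_congr (s := t \ s) (f := s.piecewise g f) (g := f)
      fun x hx => by simp [(Finset.mem_sdiff.1 hx).2]]

theorem tensorLeft_self {s t : Finset X} (h : s ⊆ t) (f : ∀ x, E x) :
    tensorLeft h f (elem s f) = elem t f := by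
  classical
  rw [tensorLeft_elem]
  exact elem_congr fun x _ => by by_cases hx : x ∈ s <;> simp [hx]

theorem tensorLeft_tensorLeft {r s t : Finset X} (h : r ⊆ s) (h' : s ⊆ t) (f : ∀ x, E x)
    (b : TSpace E r) : tensorLeft h' f (tensorLeft h f b) = tensorLeft (h.trans h') f b := by
  have : tensorLeft h' f ∘L tensorLeft h f = tensorLeft (h.trans h') f := by
    classical
    refine ext_elem fun g => ?_
    simp only [ContinuousLinearMap.comp_apply, tensorLeft_elem]
    refine elem_congr fun x hx => ?_
    by_cases h1 : x ∈ r
    · simp [h1, h h1]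
    · by_cases h2 : x ∈ s <;> simp [h1, h2]
  rw [← this]; rfl

open Classical in
/-- The bounded operator `Φ⁻¹ ∘ (1 ⊗ a) ∘ Φ`. -/
def amplify {s t : Finset X} (h : s ⊆ t) (a : TSpace E s →L[ℂ] TSpace E s) :
    TSpace E t →L[ℂ] TSpace E t :=
  (Phi h).symm.toContinuousLinearEquiv.toContinuousLinearMap ∘L
    HTensor.map (1 : TSpace E (t \ s) →L[ℂ] TSpace E (t \ s)) a ∘L
      (Phi h).toContinuousLinearEquiv.toContinuousLinearMap

theorem amplify_tensorLeft {s t : Finset X} (h : s ⊆ t) (a : TSpace E s →L[ℂ] TSpace E s)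
    (f : ∀ x, E x) (b : TSpace E s) :
    amplify h a (tensorLeft h f b) = tensorLeft h f (a b) := by
  classical
  apply (Phi h).injective
  rw [Phi_tensorLeft]
  simp [amplify, Phi_tensorLeft, HTensor.map]

theorem ext_tensorLeft {s t : Finset X} (h : s ⊆ t) {P : Type*} [NormedAddCommGroup P]
    [NormedSpace ℂ P] {L L' : TSpace E t →L[ℂ] P}
    (H : ∀ f b, L (tensorLeft h f b) = L' (tensorLeft h f b)) : L = L' :=
  ext_elem fun f => by rw [← tensorLeft_self h f, H]

theorem amplify_eq {s t : Finset X} (h : s ⊆ t) {a : TSpace E s →L[ℂ] TSpace E s}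
    {c : TSpace E t →L[ℂ] TSpace E t}
    (H : ∀ f b, c (tensorLeft h f b) = tensorLeft h f (a b)) : amplify h a = c :=
  ext_tensorLeft h fun f b => by rw [amplify_tensorLeft, H]

theorem amplify_refl {s : Finset X} (a : TSpace E s →L[ℂ] TSpace E s) :
    amplify (subset_refl s) a = a := by
  have : ∀ (f : ∀ x, E x) (b : TSpace E s), tensorLeft (subset_refl s) f b = b := by
    intro f b
    have : tensorLeft (subset_refl s) f = ContinuousLinearMap.id ℂ _ := by
      classical
      refine ext_elem fun g => ?_
      rw [tensorLeft_elem]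
      exact elem_congr fun x hx => by simp [hx]
    rw [this]; rfl
  exact amplify_eq _ fun f b => by rw [this, this]

theorem amplify_amplify {r s t : Finset X} (h : r ⊆ s) (h' : s ⊆ t)
    (a : TSpace E r →L[ℂ] TSpace E r) :
    amplify h' (amplify h a) = amplify (h.trans h') a := by
  refine (amplify_eq _ fun f b => ?_).symm
  rw [← tensorLeft_tensorLeft h h', amplify_tensorLeft, amplify_tensorLeft,
    tensorLeft_tensorLeft]

theorem adjoint_amplify {s t : Finset X} (h : s ⊆ t) (a : TSpace E s →L[ℂ] TSpace E s) :
    amplify h (star a) = star (amplify h a) := by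
  classical
  rw [ContinuousLinearMap.star_eq_adjoint, ContinuousLinearMap.star_eq_adjoint,
    ContinuousLinearMap.eq_adjoint_iff]
  intro x y
  have h1 : ∀ (b : TSpace E s →L[ℂ] TSpace E s) (x y : TSpace E t),
      inner ℂ (amplify h b x) y = inner ℂ (HTensor.map 1 b (Phi h x)) (Phi h y) := by
    intro b x y
    rw [← (Phi h).inner_map_map]
    simp [amplify]
  rw [← inner_conj_symm x, h1, h1, inner_conj_symm, HTensor.inner_map, star_one,
    ContinuousLinearMap.star_eq_adjoint]

/-- The unital `*`-homomorphism `ι : 𝓑 s → 𝓑 t`, `a ↦ Φ⁻¹ ∘ (1 ⊗ a) ∘ Φ`. -/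
def amp {s t : Finset X} (h : s ⊆ t) :
    (TSpace E s →L[ℂ] TSpace E s) →⋆ₐ[ℂ] (TSpace E t →L[ℂ] TSpace E t) where
  toFun := amplify h
  map_one' := amplify_eq h fun f b => rfl
  map_mul' a b := amplify_eq h fun f c => by simp [amplify_tensorLeft]
  map_zero' := amplify_eq h fun f b => by simp
  map_add' a b := amplify_eq h fun f c => by simp [amplify_tensorLeft]
  commutes' z := amplify_eq h fun f b => by simp [Algebra.algebraMap_eq_smul_one]
  map_star' := adjoint_amplify h

end Phi

end Family

/-! ## States, inductive limits of C*-algebras and projective limits of state spaces -/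

section States

/-- A state on a unital C*-algebra: a positive linear functional of norm one. -/
@[ext]
structure State (A : Type*) [CStarAlgebra A] where
  /-- The underlying bounded linear functional. -/
  toCLM : A →L[ℂ] ℂ
  nonneg' : ∀ a, 0 ≤ toCLM (star a * a)
  norm_eq_one' : ‖toCLM‖ = 1

namespace State

variable {A B : Type*} [CStarAlgebra A] [CStarAlgebra B]

instance : FunLike (State A) A ℂ where
  coe φ := φ.toCLM
  coe_injective _ _ h := State.ext (DFunLike.coe_injective h)

theorem map_star_eq (φ : A →ₗ[ℂ] ℂ) (h : ∀ a, 0 ≤ φ (star a * a)) (a : A) :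
    φ (star a) = starRingEnd ℂ (φ a) := by
  have h1 := (Complex.nonneg_iff.1 (h (1 + a))).2
  have h2 := (Complex.nonneg_iff.1 (h (1 + Complex.I • a))).2
  have h3 := (Complex.nonneg_iff.1 (h 1)).2
  have h4 := (Complex.nonneg_iff.1 (h a)).2
  simp [add_mul, mul_add, smul_smul] at h1 h2 h3 h4
  apply Complex.ext
  · simp; linarith
  · simp; linarith

theorem norm_sq_le (φ : A →ₗ[ℂ] ℂ) (h : ∀ a, 0 ≤ φ (star a * a)) (a : A) :
    ‖φ a‖ * ‖φ a‖ ≤ (φ 1).re * (φ (star a * a)).re := by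
  let c : PreInnerProductSpace.Core ℂ A :=
    { inner x y := φ (star x * y)
      conj_inner_symm x y := by
        rw [← map_star_eq φ h]; simp
      re_inner_nonneg x := (Complex.nonneg_iff.1 (h x)).1
      add_left x y z := by simp [add_mul]
      smul_left x y z := by simp }
  have := @InnerProductSpace.Core.inner_mul_inner_self_le ℂ A _ _ _ c 1 a
  have h1 : @inner ℂ A c.toInner 1 a = φ a := by change φ (star 1 * a) = _; simp
  have h2 : @inner ℂ A c.toInner a 1 = starRingEnd ℂ (φ a) := by
    change φ (star a * 1) = _; simp [map_star_eq φ h]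
  have h3 : @inner ℂ A c.toInner 1 1 = φ 1 := by change φ (star 1 * 1) = _; simp
  have h4 : @inner ℂ A c.toInner a a = φ (star a * a) := rfl
  rw [h1, h2, h3, h4] at this
  simpa using this

theorem map_one_of {φ : A →L[ℂ] ℂ} (h : ∀ a, 0 ≤ φ (star a * a)) (h' : ‖φ‖ = 1) : φ 1 = 1 := by
  have hp : 0 ≤ φ 1 := by simpa using h 1
  obtain ⟨hre, him⟩ := Complex.nonneg_iff.1 hp
  have hn : ‖(1 : A)‖ ≤ 1 := by
    rcases subsingleton_or_nontrivial A with _ | _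
    · simp [Subsingleton.elim (1 : A) 0]
    · exact CStarRing.norm_one.le
  have hn1 : ‖φ 1‖ = (φ 1).re := by
    conv_lhs => rw [Complex.eq_coe_norm_of_nonneg hp]
    rw [Complex.norm_real, norm_norm]
    conv_rhs => rw [Complex.eq_coe_norm_of_nonneg hp]
    simp
  have hle : (φ 1).re ≤ 1 := by
    rw [← hn1]
    exact (φ.le_opNorm 1).trans (by rw [h']; linarith)
  have hge : 1 ≤ √(φ 1).re := by
    rw [← h']
    refine φ.opNorm_le_bound (Real.sqrt_nonneg _) fun a => ?_
    refine abs_le_of_sq_le_sq' ?_ (by positivity) |>.2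
    rw [mul_pow, Real.sq_sqrt hre, pow_two, pow_two, ← CStarRing.norm_star_mul_self (x := a)]
    refine (norm_sq_le φ.toLinearMap h a).trans ?_
    refine mul_le_mul_of_nonneg_left ?_ hre
    refine (Complex.re_le_norm _).trans ((φ.le_opNorm _).trans ?_)
    rw [h', one_mul]
  have : (φ 1).re = 1 := by
    refine le_antisymm hle ?_
    rw [Real.one_le_sqrt] at hge
    exact hge
  exact Complex.ext this him.symm

theorem map_one (φ : State A) : φ 1 = 1 := map_one_of φ.nonneg' φ.norm_eq_one'

theorem norm_eq_one_of {φ : A →L[ℂ] ℂ} (h : ∀ a, ‖φ a‖ ≤ ‖a‖) (h1 : φ 1 = 1) : ‖φ‖ = 1 := by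
  refine le_antisymm (φ.opNorm_le_bound zero_le_one fun a => by simpa using h a) ?_
  have hn : ‖(1 : A)‖ ≤ 1 := by
    rcases subsingleton_or_nontrivial A with _ | _
    · simp [Subsingleton.elim (1 : A) 0]
    · exact CStarRing.norm_one.le
  have := φ.le_opNorm 1
  rw [h1, norm_one] at this
  nlinarith [norm_nonneg φ]

theorem norm_apply_le (φ : State A) (a : A) : ‖φ a‖ ≤ ‖a‖ := by
  have := φ.toCLM.le_opNorm a
  rwa [φ.norm_eq_one', one_mul] at this

/-- The pull-back of a state along a unital `*`-homomorphism. -/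
def comap (f : A →⋆ₐ[ℂ] B) (φ : State B) : State A where
  toCLM := φ.toCLM ∘L (f : A →ₗ[ℂ] B).mkContinuous 1
    fun a => by simpa using NonUnitalStarAlgHom.norm_apply_le f a
  nonneg' a := by simpa [map_star] using φ.nonneg' (f a)
  norm_eq_one' := norm_eq_one_of
    (fun a => (φ.norm_apply_le (f a)).trans (NonUnitalStarAlgHom.norm_apply_le f a))
    ((congrArg φ (_root_.map_one f)).trans φ.map_one)

@[simp]
theorem comap_apply (f : A →⋆ₐ[ℂ] B) (φ : State B) (a : A) : comap f φ a = φ (f a) := rfl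

/-- The weak-* topology on the set of states. -/
instance : TopologicalSpace (State A) := .induced (fun φ (a : A) => φ a) inferInstance

end State

end States

section Limits

open UniformSpace

variable {Λ : Type*} [Preorder Λ] [IsDirectedOrder Λ] [Nonempty Λ] {A : Λ → Type*}
  [∀ i, CStarAlgebra (A i)] (f : ∀ i j, i ≤ j → A i →⋆ₐ[ℂ] A j)

/-- The algebraic inductive limit of an inductive family of unital C*-algebras with injective
connecting unital `*`-homomorphisms. -/
def AlgLimit [DirectedSystem A (f · · ·)] (_ : ∀ i j h, Function.Injective (f i j h)) : Type _ :=
  DirectLimit A f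

variable [DirectedSystem A (f · · ·)] {hf : ∀ i j h, Function.Injective (f i j h)}

namespace AlgLimit

instance : Ring (AlgLimit f hf) := inferInstanceAs (Ring (DirectLimit A f))
instance : Algebra ℂ (AlgLimit f hf) := inferInstanceAs (Algebra ℂ (DirectLimit A f))

variable (hf) in
/-- The canonical map to the algebraic inductive limit. -/
def mk (i : Λ) (a : A i) : AlgLimit f hf := (⟦⟨i, a⟩⟧ : DirectLimit A f)

variable (hf) in
theorem mk_map {i j : Λ} (h : i ≤ j) (a : A i) : mk f hf j (f i j h a) = mk f hf i a :=
  (DirectLimit.eq_of_le (f := f) ⟨i, a⟩ j h).symm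

theorem exists_mk (x : AlgLimit f hf) : ∃ i a, x = mk f hf i a := DirectLimit.exists_eq_mk _ x

theorem exists_mk₂ (x y : AlgLimit f hf) : ∃ i a b, x = mk f hf i a ∧ y = mk f hf i b :=
  DirectLimit.exists_eq_mk₂ _ x y

theorem mk_add (i : Λ) (a b : A i) : mk f hf i (a + b) = mk f hf i a + mk f hf i b :=
  (DirectLimit.add_def (f := f) i a b).symm

theorem mk_mul (i : Λ) (a b : A i) : mk f hf i (a * b) = mk f hf i a * mk f hf i b :=
  (DirectLimit.mul_def (f := f) i a b).symm

theorem mk_neg (i : Λ) (a : A i) : mk f hf i (-a) = - mk f hf i a :=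
  (DirectLimit.neg_def (f := f) i a).symm

theorem mk_zero (i : Λ) : mk f hf i 0 = 0 := (DirectLimit.zero_def (f := f) i).symm

theorem mk_one (i : Λ) : mk f hf i 1 = 1 := (DirectLimit.one_def (f := f) i).symm

theorem mk_smul (i : Λ) (c : ℂ) (a : A i) : mk f hf i (c • a) = c • mk f hf i a :=
  (DirectLimit.smul_def (f := f) i a c).symm

instance : StarRing (AlgLimit f hf) where
  star := DirectLimit.map f f (fun _ x ↦ star x) fun i j h x ↦ map_star (f i j h) x
  star_involutive x := by
    obtain ⟨i, a, rfl⟩ := exists_mk f x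
    exact congrArg (mk f hf i) (star_star a)
  star_mul x y := by
    obtain ⟨i, a, b, rfl, rfl⟩ := exists_mk₂ f x y
    rw [← mk_mul]
    exact (congrArg (mk f hf i) (star_mul a b)).trans (mk_mul _ _ _ _)
  star_add x y := by
    obtain ⟨i, a, b, rfl, rfl⟩ := exists_mk₂ f x y
    rw [← mk_add]
    exact (congrArg (mk f hf i) (star_add a b)).trans (mk_add _ _ _ _)

theorem mk_star (i : Λ) (a : A i) : mk f hf i (star a) = star (mk f hf i a) := rfl

/-- The C*-norm on the algebraic inductive limit. -/
def normFun (x : AlgLimit f hf) : ℝ :=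
  DirectLimit.lift f (fun _ a => ‖a‖)
    (fun i j h a => (NonUnitalStarAlgHom.norm_map (f i j h) (hf i j h) a).symm) x

theorem normFun_mk (i : Λ) (a : A i) : normFun f (mk f hf i a) = ‖a‖ := rfl

instance : NormedRing (AlgLimit f hf) :=
  RingNorm.toNormedRing
    { toFun := normFun f
      map_zero' := by
        obtain ⟨i⟩ := ‹Nonempty Λ›
        rw [← mk_zero f i, normFun_mk, norm_zero]
      add_le' x y := by
        obtain ⟨i, a, b, rfl, rfl⟩ := exists_mk₂ f x y
        rw [← mk_add, normFun_mk, normFun_mk, normFun_mk]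
        exact norm_add_le a b
      neg' x := by
        obtain ⟨i, a, rfl⟩ := exists_mk f x
        rw [← mk_neg, normFun_mk, normFun_mk, norm_neg]
      mul_le' x y := by
        obtain ⟨i, a, b, rfl, rfl⟩ := exists_mk₂ f x y
        rw [← mk_mul, normFun_mk, normFun_mk, normFun_mk]
        exact norm_mul_le a b
      eq_zero_of_map_eq_zero' x hx := by
        obtain ⟨i, a, rfl⟩ := exists_mk f x
        rw [normFun_mk, norm_eq_zero] at hx
        rw [hx, mk_zero] }

theorem norm_mk (i : Λ) (a : A i) : ‖mk f hf i a‖ = ‖a‖ := rfl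

instance : NormedAlgebra ℂ (AlgLimit f hf) where
  norm_smul_le c x := by
    obtain ⟨i, a, rfl⟩ := exists_mk f x
    rw [← mk_smul, norm_mk, norm_mk, norm_smul]

instance : StarModule ℂ (AlgLimit f hf) where
  star_smul c x := by
    obtain ⟨i, a, rfl⟩ := exists_mk f x
    rw [← mk_smul, ← mk_star, star_smul, mk_smul, mk_star]

instance : CStarRing (AlgLimit f hf) where
  norm_mul_self_le x := by
    obtain ⟨i, a, rfl⟩ := exists_mk f x
    rw [← mk_star, ← mk_mul, norm_mk, norm_mk]
    exact CStarRing.norm_mul_self_le a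

end AlgLimit

variable (hf) in
/-- The inductive limit C*-algebra: the completion of the algebraic inductive limit. -/
def CStarLimit : Type _ := Completion (AlgLimit f hf)

namespace CStarLimit

instance : NormedRing (CStarLimit f hf) := inferInstanceAs (NormedRing (Completion _))
instance : CompleteSpace (CStarLimit f hf) := inferInstanceAs (CompleteSpace (Completion _))
instance : Algebra ℂ (CStarLimit f hf) :=
  inferInstanceAs (Algebra ℂ (Completion (AlgLimit f hf)))

/-- The dense embedding of the algebraic inductive limit. -/
def ofAlg (x : AlgLimit f hf) : CStarLimit f hf := (x : Completion (AlgLimit f hf))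

theorem norm_ofAlg (x : AlgLimit f hf) : ‖ofAlg f x‖ = ‖x‖ := Completion.norm_coe x
theorem ofAlg_add (x y : AlgLimit f hf) : ofAlg f (x + y) = ofAlg f x + ofAlg f y :=
  Completion.coe_add x y
theorem ofAlg_mul (x y : AlgLimit f hf) : ofAlg f (x * y) = ofAlg f x * ofAlg f y :=
  Completion.coe_mul x y
theorem ofAlg_smul (c : ℂ) (x : AlgLimit f hf) : ofAlg f (c • x) = c • ofAlg f x :=
  Completion.coe_smul c x

theorem induction {p : CStarLimit f hf → Prop} (hp : IsClosed {x | p x})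
    (h : ∀ x, p (ofAlg f x)) (x : CStarLimit f hf) : p x :=
  Completion.induction_on x hp h

theorem induction₂ {p : CStarLimit f hf → CStarLimit f hf → Prop}
    (hp : IsClosed {x : CStarLimit f hf × CStarLimit f hf | p x.1 x.2})
    (h : ∀ x y, p (ofAlg f x) (ofAlg f y)) (x y : CStarLimit f hf) : p x y :=
  Completion.induction_on₂ x y hp h

instance : NormedAlgebra ℂ (CStarLimit f hf) where
  norm_smul_le c x := norm_smul_le (β := Completion (AlgLimit f hf)) c x

instance : Star (CStarLimit f hf) where
  star := Completion.map (star : AlgLimit f hf → AlgLimit f hf)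

theorem ofAlg_star (x : AlgLimit f hf) : ofAlg f (star x) = star (ofAlg f x) :=
  (Completion.map_coe (star_isometry (E := AlgLimit f hf)).uniformContinuous x).symm

theorem continuous_star' : Continuous (star : CStarLimit f hf → CStarLimit f hf) :=
  Completion.continuous_map

instance : StarRing (CStarLimit f hf) where
  star_involutive x := by
    induction x using induction f with
    | hp => exact isClosed_eq ((continuous_star' f).comp (continuous_star' f)) continuous_id
    | h x => rw [← ofAlg_star, ← ofAlg_star, star_star]
  star_mul x y := by
    induction x, y using induction₂ f with
    | hp =>
      exact isClosed_eq ((continuous_star' f).comp continuous_mul)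
        (((continuous_star' f).comp continuous_snd).mul ((continuous_star' f).comp continuous_fst))
    | h x y => rw [← ofAlg_mul, ← ofAlg_star, ← ofAlg_star, ← ofAlg_star, star_mul, ofAlg_mul]
  star_add x y := by
    induction x, y using induction₂ f with
    | hp =>
      exact isClosed_eq ((continuous_star' f).comp continuous_add)
        (((continuous_star' f).comp continuous_fst).add ((continuous_star' f).comp continuous_snd))
    | h x y => rw [← ofAlg_add, ← ofAlg_star, ← ofAlg_star, ← ofAlg_star, star_add, ofAlg_add]

instance : CStarRing (CStarLimit f hf) where
  norm_mul_self_le x := by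
    induction x using induction f with
    | hp =>
      exact isClosed_le (continuous_norm.mul continuous_norm)
        (((continuous_star' f).mul continuous_id).norm)
    | h x =>
      rw [← ofAlg_star, ← ofAlg_mul, norm_ofAlg, norm_ofAlg]
      exact CStarRing.norm_mul_self_le x

instance : StarModule ℂ (CStarLimit f hf) where
  star_smul c x := by
    induction x using induction f with
    | hp =>
      exact isClosed_eq ((continuous_star' f).comp (continuous_const_smul c))
        ((continuous_const_smul (star c)).comp (continuous_star' f))
    | h x => rw [← ofAlg_smul, ← ofAlg_star, ← ofAlg_star, star_smul, ofAlg_smul]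

instance : CStarAlgebra (CStarLimit f hf) where

variable (hf) in
/-- The canonical `*`-homomorphism from a member of the inductive family to the inductive
limit. -/
def of (i : Λ) : A i →⋆ₐ[ℂ] CStarLimit f hf where
  toFun a := ofAlg f (AlgLimit.mk f hf i a)
  map_one' := congrArg (ofAlg f) (AlgLimit.mk_one f i)
  map_mul' a b := by rw [AlgLimit.mk_mul, ofAlg_mul]
  map_zero' := congrArg (ofAlg f) (AlgLimit.mk_zero f i)
  map_add' a b := by rw [AlgLimit.mk_add, ofAlg_add]
  commutes' c := by
    rw [Algebra.algebraMap_eq_smul_one, Algebra.algebraMap_eq_smul_one, AlgLimit.mk_smul,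
      AlgLimit.mk_one, ofAlg_smul]
    rfl
  map_star' a := by rw [AlgLimit.mk_star, ofAlg_star]

theorem of_map {i j : Λ} (h : i ≤ j) (a : A i) : of f hf j (f i j h a) = of f hf i a :=
  congrArg (ofAlg f) (AlgLimit.mk_map f hf h a)

end CStarLimit

/-- The projective limit of the state spaces, with respect to the pull-backs along the connecting
`*`-homomorphisms. -/
def ProjStates : Type _ :=
  {s : ∀ i, State (A i) // ∀ i j (h : i ≤ j), State.comap (f i j h) (s j) = s i}

namespace ProjStates

/-- The projection to a member of the projective family. -/
def proj (s : ProjStates f) (i : Λ) : State (A i) := s.1 i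

theorem proj_map (s : ProjStates f) {i j : Λ} (h : i ≤ j) (a : A i) :
    s.proj f j (f i j h a) = s.proj f i a :=
  DFunLike.congr_fun (s.2 i j h) a

/-- The projective limit topology. -/
instance : TopologicalSpace (ProjStates f) := inferInstanceAs (TopologicalSpace (Subtype _))

variable (hf) in
/-- The linear functional on the algebraic inductive limit given by a family of states. -/
def algFun (s : ProjStates f) : AlgLimit f hf →L[ℂ] ℂ :=
  LinearMap.mkContinuous
    { toFun := fun x => DirectLimit.lift f (fun i a => s.proj f i a)
        (fun i j h a => (s.proj_map f h a).symm) x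
      map_add' := fun x y => by
        obtain ⟨i, a, b, rfl, rfl⟩ := AlgLimit.exists_mk₂ f x y
        rw [← AlgLimit.mk_add]
        exact (s.proj f i).toCLM.map_add a b
      map_smul' := fun c x => by
        obtain ⟨i, a, rfl⟩ := AlgLimit.exists_mk f x
        rw [← AlgLimit.mk_smul]
        exact (s.proj f i).toCLM.map_smul c a } 1
    fun x => by
      obtain ⟨i, a, rfl⟩ := AlgLimit.exists_mk f x
      rw [one_mul]
      exact (s.proj f i).norm_apply_le a

theorem algFun_mk (s : ProjStates f) (i : Λ) (a : A i) :
    algFun f hf s (AlgLimit.mk f hf i a) = s.proj f i a := rfl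

variable (hf) in
/-- The bounded functional on the inductive limit which extends a family of states. -/
def limFun (s : ProjStates f) : CStarLimit f hf →L[ℂ] ℂ :=
  (algFun f hf s).fromCompletion

theorem limFun_ofAlg (s : ProjStates f) (x : AlgLimit f hf) :
    limFun f hf s (CStarLimit.ofAlg f x) = algFun f hf s x :=
  ContinuousLinearMap.fromCompletion_apply_coe _ _

variable (hf) in
/-- The state on the inductive limit C*-algebra defined by an element `s` of the projective limit;
it is the state with `(s.toState) (of i a) = s i a`, see `toState_of`. -/
def toState (s : ProjStates f) : State (CStarLimit f hf) where
  toCLM := limFun f hf s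
  nonneg' x := by
    induction x using CStarLimit.induction f with
    | hp =>
      exact isClosed_Ici.preimage ((limFun f hf s).continuous.comp (continuous_star.mul continuous_id))
    | h x =>
      rw [← CStarLimit.ofAlg_star, ← CStarLimit.ofAlg_mul, limFun_ofAlg]
      obtain ⟨i, a, rfl⟩ := AlgLimit.exists_mk f x
      rw [← AlgLimit.mk_star, ← AlgLimit.mk_mul]
      exact (s.proj f i).nonneg' a
  norm_eq_one' := by
    refine State.norm_eq_one_of (fun x => ?_) ?_
    · induction x using CStarLimit.induction f with
      | hp => exact isClosed_le (limFun f hf s).continuous.norm continuous_norm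
      | h x =>
        rw [limFun_ofAlg, CStarLimit.norm_ofAlg]
        obtain ⟨i, a, rfl⟩ := AlgLimit.exists_mk f x
        exact (s.proj f i).norm_apply_le a
    · obtain ⟨i⟩ := ‹Nonempty Λ›
      rw [← map_one (CStarLimit.of f hf i)]
      exact (limFun_ofAlg f s _).trans (s.proj f i).map_one

theorem toState_of (s : ProjStates f) (i : Λ) (a : A i) :
    toState f hf s (CStarLimit.of f hf i a) = s.proj f i a :=
  limFun_ofAlg f s _

end ProjStates

end Limits

/-! ## Observables and states over a family of Hilbert spaces -/

section Kijowski

variable {X : Type*} (E : X → Type*)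
  [∀ x, NormedAddCommGroup (E x)] [∀ x, InnerProductSpace ℂ (E x)]

/-- The C*-algebra of all bounded operators on the Hilbert space `⨂ x ∈ s, E x`. -/
abbrev Obs (s : Finset X) : Type _ := TSpace E s →L[ℂ] TSpace E s

/-- The inductive family `ι` of the algebras `Obs E s`, indexed by the finite sets `s`. -/
def ampSys (s t : Finset X) (h : s ≤ t) : Obs E s →⋆ₐ[ℂ] Obs E t := amp h

instance : DirectedSystem (Obs E) (ampSys E · · ·) where
  map_self _ a := amplify_refl a
  map_map _ _ _ h h' a := amplify_amplify h h' a

theorem ampSys_injective [∀ x, Nontrivial (E x)] (s t : Finset X) (h : s ≤ t) :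
    Function.Injective (ampSys E s t h) := by
  classical
  intro a b hab
  choose f hf using fun x => exists_ne (0 : E x)
  ext v
  have h1 : tensorLeft h f (a v) = tensorLeft h f (b v) := by
    rw [← amplify_tensorLeft, ← amplify_tensorLeft]
    exact congrArg (fun c : Obs E t => c (tensorLeft h f v)) hab
  have h2 : elem (t \ s) f ≠ 0 := by
    intro h0
    have := inner_elem (t \ s) f f
    rw [h0, inner_zero_left] at this
    exact Finset.prod_ne_zero_iff.2 (fun x _ => inner_self_ne_zero.2 (hf x)) this.symm
  have h3 : ‖tensorLeft h f (a v - b v)‖ = ‖elem (t \ s) f‖ * ‖a v - b v‖ := by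
    rw [← (Phi h).norm_map, Phi_tensorLeft, UniformSpace.Completion.norm_coe,
      TensorProduct.norm_tmul]
  rw [map_sub, h1, sub_self, norm_zero, eq_comm, mul_eq_zero, norm_eq_zero, norm_eq_zero,
    sub_eq_zero] at h3
  exact h3.resolve_left h2

/-- The C*-algebra of quantum observables: the inductive limit of the algebras `Obs E s`. -/
abbrev Observables [∀ x, Nontrivial (E x)] : Type _ := CStarLimit (ampSys E) (ampSys_injective E)

/-- The canonical map `Obs E s → Observables E`. -/
abbrev Observables.of [∀ x, Nontrivial (E x)] (s : Finset X) : Obs E s →⋆ₐ[ℂ] Observables E :=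
  CStarLimit.of (ampSys E) (ampSys_injective E) s

/-- The space of quantum states: the projective limit of the state spaces of the algebras
`Obs E s`. -/
abbrev QuantumStates : Type _ := ProjStates (ampSys E)

variable {E} in
/-- The component in the state space of `Obs E s` of a quantum state. -/
abbrev QuantumStates.proj (σ : QuantumStates E) (s : Finset X) : State (Obs E s) :=
  ProjStates.proj (ampSys E) σ s

variable {E} in
/-- The state on the algebra of quantum observables which is defined by a quantum state. -/
abbrev QuantumStates.toState [∀ x, Nontrivial (E x)] (σ : QuantumStates E) :
    State (Observables E) :=
  ProjStates.toState (ampSys E) (ampSys_injective E) σ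

end Kijowski

/-! ## Scalar products and invariant measures -/

section Metrics

open MeasureTheory

/-- The set `Γ` of scalar products of signature `(p, q)` on a real vector space `V`. -/
@[ext]
structure ScalarProduct (p q : ℕ) (V : Type*) [AddCommGroup V] [Module ℝ V] where
  /-- The underlying bilinear form. -/
  form : LinearMap.BilinForm ℝ V
  symm' : ∀ v w, form v w = form w v
  nondegenerate' : ∀ v, (∀ w, form v w = 0) → v = 0
  signature' : ∃ b : Module.Basis (Fin p ⊕ Fin q) ℝ V, (∀ i j, i ≠ j → form (b i) (b j) = 0) ∧
    (∀ i, form (b (.inl i)) (b (.inl i)) = 1) ∧ (∀ j, form (b (.inr j)) (b (.inr j)) = -1)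

namespace ScalarProduct

variable {p q : ℕ} {V W : Type*} [AddCommGroup V] [Module ℝ V] [AddCommGroup W] [Module ℝ W]

/-- The topology of pointwise convergence of the values `γ v w`; as `V` is finite dimensional, this
is the topology given by the coordinates `γ (v i) (v j)` with respect to any basis. -/
instance : TopologicalSpace (ScalarProduct p q V) :=
  .induced (fun γ (v w : V) => γ.form v w) inferInstance

instance : MeasurableSpace (ScalarProduct p q V) := borel _
instance : BorelSpace (ScalarProduct p q V) := ⟨rfl⟩

/-- The pull-back `(l^* γ) (v, w) = γ (l v, l w)` along a linear isomorphism, as a map between sets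
of scalar products. -/
def pullbackFun (l : V ≃ₗ[ℝ] W) (γ : ScalarProduct p q W) : ScalarProduct p q V where
  form := γ.form.compl₁₂ l.toLinearMap l.toLinearMap
  symm' v w := γ.symm' (l v) (l w)
  nondegenerate' v h := by
    have := γ.nondegenerate' (l v) fun w => by simpa using h (l.symm w)
    simpa using this
  signature' := by
    obtain ⟨b, h1, h2, h3⟩ := γ.signature'
    exact ⟨b.map l.symm, by simpa using h1, by simpa using h2, by simpa using h3⟩

theorem continuous_pullbackFun (l : V ≃ₗ[ℝ] W) :
    Continuous (pullbackFun (p := p) (q := q) l) := by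
  refine continuous_induced_rng.2 (continuous_pi fun v => continuous_pi fun w => ?_)
  exact (continuous_apply (l w)).comp ((continuous_apply (l v)).comp
    (continuous_induced_dom (f := fun (γ : ScalarProduct p q W) (v w : W) => γ.form v w)))

/-- The pull-back of scalar products along a linear isomorphism, as a homeomorphism. -/
def pullback (l : V ≃ₗ[ℝ] W) : ScalarProduct p q W ≃ₜ ScalarProduct p q V where
  toFun := pullbackFun l
  invFun := pullbackFun l.symm
  left_inv γ := by ext v w; simp [pullbackFun]
  right_inv γ := by ext v w; simp [pullbackFun]
  continuous_toFun := continuous_pullbackFun l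
  continuous_invFun := continuous_pullbackFun l.symm

/-- A measure on `Γ` is invariant if it is preserved by the action `g γ = (g⁻¹)^* γ` of the general
linear group. -/
def IsInvariant (μ : Measure (ScalarProduct p q V)) : Prop :=
  ∀ g : V ≃ₗ[ℝ] V, μ.map (pullback g.symm) = μ

end ScalarProduct

open scoped Manifold ContDiff

/-- A diffeomorphism invariant field of invariant measures: the field `x ↦ μ x` of measures on the
sets of scalar products of signature `(p, q)` on the tangent spaces, which is obtained from a
non-zero invariant regular Borel measure `μ₀` at one point `x₀`, by pushing it forward by the
pull-backs along linear isomorphisms `l : T_x M → T_{x₀} M`. -/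
structure InvariantMeasureField (n p q : ℕ) (M : Type*) [TopologicalSpace M]
    [ChartedSpace (EuclideanSpace ℝ (Fin n)) M] where
  /-- The measure at a point. -/
  measure : ∀ x : M, Measure (ScalarProduct p q (TangentSpace (𝓡 n) x))
  exists_eq' : ∃ (x₀ : M) (μ₀ : Measure (ScalarProduct p q (TangentSpace (𝓡 n) x₀))),
    μ₀.Regular ∧ μ₀ ≠ 0 ∧ ScalarProduct.IsInvariant μ₀ ∧
      ∀ x, ∃ l : TangentSpace (𝓡 n) x ≃ₗ[ℝ] TangentSpace (𝓡 n) x₀,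
        measure x = μ₀.map (ScalarProduct.pullback l)

namespace InvariantMeasureField

variable {n p q : ℕ} {M : Type*} [TopologicalSpace M]
  [ChartedSpace (EuclideanSpace ℝ (Fin n)) M]

/-- The Hilbert space `L²(Γ_x, dμ_x)`. -/
abbrev L2 (μ : InvariantMeasureField n p q M) (x : M) : Type := Lp ℂ 2 (μ.measure x)

theorem nontrivial_Lp {Y : Type*} [TopologicalSpace Y] [MeasurableSpace Y] [BorelSpace Y]
    (μ : Measure Y) [μ.Regular] (h : μ ≠ 0) : Nontrivial (Lp ℂ 2 μ) := by
  obtain ⟨K, -, hK, hpos⟩ := isOpen_univ.exists_lt_isCompact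
    (show 0 < μ Set.univ from pos_iff_ne_zero.2 (Measure.measure_univ_ne_zero.2 h))
  have hfin : μ (toMeasurable μ K) ≠ ⊤ := by
    rw [measure_toMeasurable]; exact hK.measure_lt_top.ne
  refine ⟨indicatorConstLp 2 (measurableSet_toMeasurable μ K) hfin (1 : ℂ), 0, fun h0 => ?_⟩
  have := congrArg norm h0
  rw [norm_indicatorConstLp (by norm_num) (by norm_num), norm_zero] at this
  simp [Measure.real, measure_toMeasurable, ENNReal.toReal_eq_zero_iff, hpos.ne',
    hK.measure_lt_top.ne] at this

instance (μ : InvariantMeasureField n p q M) (x : M) : Nontrivial (μ.L2 x) := by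
  obtain ⟨x₀, μ₀, hr, h0, -, h⟩ := μ.exists_eq'
  obtain ⟨l, hl⟩ := h x
  have : (μ.measure x).Regular := by rw [hl]; exact hr.map _
  refine nontrivial_Lp _ ?_
  rw [hl]
  exact (Measure.map_ne_zero_iff (ScalarProduct.pullback l).measurable.aemeasurable).2 h0

end InvariantMeasureField

/-- The maps `U_s Ψ = c ^ (-#s / 2) Ψ` from `⨂ x ∈ s, L²(dμ_x)` to `⨂ x ∈ s, L²(dν_x)`, in the case
`ν = c μ`: the tensor product of functions `f x` in `L²(dμ_x)` is mapped to `c ^ (-#s / 2)` times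
the tensor product of the same functions, which in `L²(dν_x)` are called `g x`. -/
def IsRescaling {n p q : ℕ} {M : Type*} [TopologicalSpace M]
    [ChartedSpace (EuclideanSpace ℝ (Fin n)) M] {μ ν : InvariantMeasureField n p q M} (c : ℝ)
    (U : ∀ s : Finset M, TSpace μ.L2 s ≃ₗᵢ[ℂ] TSpace ν.L2 s) : Prop :=
  ∀ (s : Finset M) (f : ∀ x, μ.L2 x) (g : ∀ x, ν.L2 x),
    (∀ x ∈ s, f x =ᵐ[μ.measure x] g x) →
      U s (elem s f) = ((1 / √c ^ s.card : ℝ) : ℂ) • elem s g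

end Metrics

/-! ## Compatibility of isomorphisms with the constructions -/

section Compatibility

variable {X : Type*} {E F : X → Type*}
  [∀ x, NormedAddCommGroup (E x)] [∀ x, InnerProductSpace ℂ (E x)]
  [∀ x, NormedAddCommGroup (F x)] [∀ x, InnerProductSpace ℂ (F x)]

open Classical in
/-- `U t = U (t \ s) ⊗ U s` for `s ⊆ t`, under the identifications `Phi`. -/
def IsTensorCompatible (U : ∀ s : Finset X, TSpace E s ≃ₗᵢ[ℂ] TSpace F s) : Prop :=
  ∀ (s t : Finset X) (h : s ⊆ t) (Ψ : TSpace E t),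
    Phi h (U t Ψ) =
      HTensor.map (U (t \ s)).toContinuousLinearEquiv.toContinuousLinearMap
        (U s).toContinuousLinearEquiv.toContinuousLinearMap (Phi h Ψ)

/-- The isomorphism `u s : a ↦ U s ∘ a ∘ (U s)⁻¹` of C*-algebras. -/
def conjObs (U : ∀ s : Finset X, TSpace E s ≃ₗᵢ[ℂ] TSpace F s) (s : Finset X) :
    Obs E s ≃⋆ₐ[ℂ] Obs F s :=
  (U s).conjStarAlgEquiv

/-- The isomorphisms `u s` intertwine the connecting maps of the two inductive families. -/
def IntertwinesFamilies (U : ∀ s : Finset X, TSpace E s ≃ₗᵢ[ℂ] TSpace F s) : Prop :=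
  ∀ (s t : Finset X) (h : s ≤ t) (a : Obs E s),
    ampSys F s t h (conjObs U s a) = conjObs U t (ampSys E s t h a)

/-- `𝒰` is induced by the family `u` on the inductive limits. -/
def IsInducedOnObservables [∀ x, Nontrivial (E x)] [∀ x, Nontrivial (F x)]
    (U : ∀ s : Finset X, TSpace E s ≃ₗᵢ[ℂ] TSpace F s)
    (𝒰 : Observables E ≃⋆ₐ[ℂ] Observables F) : Prop :=
  ∀ (s : Finset X) (a : Obs E s), 𝒰 (Observables.of E s a) = Observables.of F s (conjObs U s a)

/-- `𝒱` is induced by the pull-backs of states along the `u s` on the projective limits. -/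
def IsInducedOnStates (U : ∀ s : Finset X, TSpace E s ≃ₗᵢ[ℂ] TSpace F s)
    (𝒱 : QuantumStates F → QuantumStates E) : Prop :=
  ∀ (σ : QuantumStates F) (s : Finset X) (a : Obs E s),
    (𝒱 σ).proj s a = σ.proj s (conjObs U s a)

/-- `σ = r σ₁ + (1 - r) σ₂`. -/
def IsConvexCombination (r : ℝ) (σ σ₁ σ₂ : QuantumStates E) : Prop :=
  ∀ (s : Finset X) (a : Obs E s),
    σ.proj s a = (r : ℂ) * σ₁.proj s a + ((1 - r : ℝ) : ℂ) * σ₂.proj s a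

end Compatibility

end Kijowski

end

open Kijowski

open scoped Manifold ContDiff

open scoped Manifold ContDiff

noncomputable section

/-! The tangent spaces all have the same underlying model space, so invariance makes every $\mu_x$
one and the same invariant measure on the scalar products of $\mathbb R^n$ (`exists_measure_eq`).
Everything then rests on the uniqueness up to scale of the invariant measure on this homogeneous
space of the general linear group.

Uniqueness of the measure is a double Fubini argument (`ae_eq_const_of_ae_invariant`), which avoids
stabilizers and quotient measures. Both measures have densities with respect to their sum $\rho$,
and such a density $f$ satisfies $f(gy)=f(y)$ for $\rho$-almost every $y$, for each $g$. Exchanging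
quantifiers against Haar measure gives a point $y_0$ with $f(gy_0)=f(y_0)$ for almost every $g$. By
transitivity, and because right translations preserve Haar null sets, $f(gy)=f(y_0)$ for every $y$
and almost every $g$. Exchanging quantifiers again gives one $g$ that works for $\rho$-almost every
$y$, and the invariance of $\rho$ removes this $g$. So the densities are constant.

If $\check\mu_x=c\,\mu_x$, then $f\mapsto f/\sqrt c$ is a Hilbert space isomorphism at each point,
and the rescaling families are exactly the family of tensor products of these isomorphisms
(`isRescaling_iff`); the factor $c^{-\#\lambda/2}$ is multilinearity. The remaining claims hold for
tensor products of arbitrary families of isomorphisms. Compatibility with the splittings is checked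
on elementary tensors, and intertwining on vectors $e\otimes b$. The map of observables comes from
the universal property of the inductive limit, the map of states is the componentwise pull-back, and
uniqueness on observables and the duality formula follow from density and automatic continuity. -/

namespace Kijowski

/-! ### Uniqueness of invariant measures under a transitive group action. -/

section InvariantMeasures

open MeasureTheory Filter

variable {G Y : Type*} [MeasurableSpace Y] [Group G] [MulAction G Y]

/-- The density of an invariant measure with respect to an invariant measure is almost
everywhere invariant. -/
theorem density_comp_smul_ae_eq [MeasurableSpace G] [MeasurableSMul G Y] {ρ μ : Measure Y}
    [SigmaFinite ρ]
    [SMulInvariantMeasure G Y ρ] [SMulInvariantMeasure G Y μ] [SigmaFinite μ] {f : Y → ENNReal}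
    (hf : Measurable f) (h : μ = ρ.withDensity f) (g : G) : (fun y => f (g • y)) =ᵐ[ρ] f := by
  have hg : Measurable fun y => f (g • y) := hf.comp (measurable_const_smul g)
  have hr : MeasurePreserving (fun y : Y => g • y) ρ ρ := measurePreserving_smul g ρ
  -- The translated function is again a density of `μ`: its integral over $A$ is that of `f` over
  -- $gA$, which is $\mu(gA)=\mu(A)$. The set $gA$ is written as the preimage of $A$ under $g^{-1}$.
  -- Densities over the σ-finite `ρ` are unique almost everywhere.
  have key : ρ.withDensity (fun y => f (g • y)) = ρ.withDensity f := by
    ext A hA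
    have hA' : MeasurableSet ((fun y : Y => g⁻¹ • y) ⁻¹' A) := measurable_const_smul g⁻¹ hA
    have hpre : (fun y : Y => g • y) ⁻¹' ((fun y : Y => g⁻¹ • y) ⁻¹' A) = A := by
      ext y; simp
    rw [withDensity_apply _ hA, ← h]
    calc ∫⁻ y in A, f (g • y) ∂ρ
        = ∫⁻ y in (fun y : Y => g⁻¹ • y) ⁻¹' A, f y ∂ρ := by
          rw [← hr.setLIntegral_comp_preimage hA' hf, hpre]
      _ = μ ((fun y : Y => g⁻¹ • y) ⁻¹' A) := by rw [h, withDensity_apply _ hA']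
      _ = μ A := measure_preimage_smul μ g⁻¹ A
  exact (withDensity_eq_iff_of_sigmaFinite hg.aemeasurable hf.aemeasurable).1 key

/-- A measurable function which is almost everywhere invariant under a transitive action is
almost everywhere constant. -/
theorem ae_eq_const_of_ae_invariant [MeasurableSpace G] [MeasurableMul₂ G] [MeasurableInv G]
    [MeasurableSMul₂ G Y] [MulAction.IsPretransitive G Y] (m : Measure G) [SFinite m]
    [m.IsMulLeftInvariant] [NeZero m] {ρ : Measure Y} [SFinite ρ] [NeZero ρ]
    {f : Y → ENNReal} (hf : Measurable f)
    (hfg : ∀ g : G, (fun y => f (g • y)) =ᵐ[ρ] f)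
    (hρ : ∀ (g : G) (A : Set Y), ρ ((fun y => g • y) ⁻¹' A) = ρ A) :
    ∃ c, f =ᵐ[ρ] fun _ => c := by
  have hE : MeasurableSet {z : G × Y | f (z.1 • z.2) = f z.2} :=
    measurableSet_eq_fun (hf.comp measurable_smul) (hf.comp measurable_snd)
  have h1 : ∀ᵐ z ∂m.prod ρ, f (z.1 • z.2) = f z.2 :=
    (Measure.ae_prod_iff_ae_ae hE).2 (.of_forall hfg)
  -- First exchange of quantifiers: the exceptional null set of points no longer depends on the
  -- group element, so a single good point `y₀` can be fixed.
  have h2 : ∀ᵐ y ∂ρ, ∀ᵐ g ∂m, f (g • y) = f y := by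
    have h3 := Measure.ae_ae_of_ae_prod (Measure.measurePreserving_swap (μ := ρ) (ν := m)
      |>.quasiMeasurePreserving.ae h1)
    exact h3
  obtain ⟨y₀, hy₀⟩ := h2.exists
  refine ⟨f y₀, ?_⟩
  have h4 : ∀ y, ∀ᵐ g ∂m, f (g • y) = f y₀ := by
    intro y
    obtain ⟨k, rfl⟩ := MulAction.exists_smul_eq G y₀ y
    -- The measure `m` is only left invariant, but right translation by `k` still preserves its null
    -- sets, which is enough to replace $g$ by $gk$.
    have := (quasiMeasurePreserving_mul_right m k).ae hy₀
    filter_upwards [this] with g hg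
    rw [← hg, mul_smul]
  have hE' : MeasurableSet {z : Y × G | f (z.2 • z.1) = f y₀} :=
    measurableSet_eq_fun (hf.comp (measurable_snd.smul measurable_fst)) measurable_const
  have h5 : ∀ᵐ z ∂ρ.prod m, f (z.2 • z.1) = f y₀ :=
    (Measure.ae_prod_iff_ae_ae hE').2 (.of_forall h4)
  -- Second exchange of quantifiers. Any one good `g` suffices: the exceptional set at `g` is the
  -- preimage under `g` of the set where `f` differs from `f y₀`.
  have h6 : ∀ᵐ g ∂m, ∀ᵐ y ∂ρ, f (g • y) = f y₀ :=
    Measure.ae_ae_of_ae_prod (Measure.measurePreserving_swap (μ := m) (ν := ρ)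
      |>.quasiMeasurePreserving.ae h5)
  obtain ⟨g, hg⟩ := h6.exists
  rw [EventuallyEq, ae_iff, ← hρ g]
  exact ae_iff.1 hg

/-- Two non-zero σ-finite measures which are invariant under a transitive action are
proportional. -/
theorem exists_smul_eq_of_invariant [MeasurableSpace G] [MeasurableMul₂ G] [MeasurableInv G]
    [MeasurableSMul₂ G Y] [MulAction.IsPretransitive G Y] (m : Measure G) [SFinite m]
    [m.IsMulLeftInvariant] [NeZero m] (μ ν : Measure Y) [SigmaFinite μ] [SigmaFinite ν]
    [SMulInvariantMeasure G Y μ] [SMulInvariantMeasure G Y ν] (hμ : μ ≠ 0) (hν : ν ≠ 0) :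
    ∃ c : ℝ, 0 < c ∧ ν = ENNReal.ofReal c • μ := by
  have : SMulInvariantMeasure G Y (μ + ν) := ⟨fun g s hs => by
    simp only [Measure.add_apply, measure_preimage_smul]⟩
  have : NeZero (μ + ν) := ⟨fun h => hμ (le_antisymm (h ▸ Measure.le_add_right le_rfl) (Measure.zero_le μ))⟩
  -- The sum serves as an invariant reference measure that dominates both `μ` and `ν`, neither of
  -- which is known in advance to dominate the other.
  have key : ∀ κ : Measure Y, SigmaFinite κ → SMulInvariantMeasure G Y κ → κ ≪ μ + ν → κ ≠ 0 →
      ∃ c : ENNReal, c ≠ 0 ∧ c ≠ ⊤ ∧ κ = c • (μ + ν) := by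
    intro κ _ _ hκ h0
    have hd := (Measure.withDensity_rnDeriv_eq κ (μ + ν) hκ).symm
    have hm := Measure.measurable_rnDeriv κ (μ + ν)
    obtain ⟨c, hc⟩ := ae_eq_const_of_ae_invariant (G := G) m hm
      (density_comp_smul_ae_eq hm hd) fun g A => measure_preimage_smul (μ + ν) g A
    have hκc : κ = c • (μ + ν) := by
      rw [hd, withDensity_congr_ae hc, withDensity_const]
    refine ⟨c, fun h => h0 (by rw [hκc, h, zero_smul]), ?_, hκc⟩
    -- The constant is finite because it is the value of an almost everywhere finite density at some
    -- point.
    obtain ⟨y, hy1, hy2⟩ := (hc.and (Measure.rnDeriv_lt_top κ (μ + ν))).exists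
    exact fun h => hy2.ne (hy1.trans h)
  obtain ⟨a, ha0, hat, ha⟩ := key μ ‹_› ‹_›
    (Measure.absolutelyContinuous_of_le (Measure.le_add_right le_rfl)) hμ
  obtain ⟨b, hb0, hbt, hb⟩ := key ν ‹_› ‹_›
    (Measure.absolutelyContinuous_of_le (Measure.le_add_left le_rfl)) hν
  have hc0 : b * a⁻¹ ≠ 0 := mul_ne_zero hb0 (ENNReal.inv_ne_zero.2 hat)
  have hct : b * a⁻¹ ≠ ⊤ := ENNReal.mul_ne_top hbt (ENNReal.inv_ne_top.2 ha0)
  refine ⟨(b * a⁻¹).toReal, ENNReal.toReal_pos hc0 hct, ?_⟩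
  rw [ENNReal.ofReal_toReal hct]
  conv_rhs => rw [ha]
  rw [smul_smul, mul_assoc, ENNReal.inv_mul_cancel ha0 hat, mul_one, ← hb]

end InvariantMeasures

/-! ### The scalar products as a homogeneous space of the general linear group. -/

namespace ScalarProduct

open MeasureTheory

variable {p q : ℕ}

section Action

variable {V : Type*} [NormedAddCommGroup V] [NormedSpace ℝ V]

/-- The action `g γ = (g⁻¹)^* γ` of the invertible bounded operators on the scalar products. -/
instance : MulAction (V →L[ℝ] V)ˣ (ScalarProduct p q V) where
  smul g γ := pullback (ContinuousLinearEquiv.unitsEquiv ℝ V g).symm.toLinearEquiv γ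
  one_smul γ := by ext v w; rfl
  mul_smul g h γ := by
    ext v w
    change γ.form (((g * h)⁻¹ : (V →L[ℝ] V)ˣ).val v) (((g * h)⁻¹ : (V →L[ℝ] V)ˣ).val w) =
      γ.form ((h⁻¹ : (V →L[ℝ] V)ˣ).val ((g⁻¹ : (V →L[ℝ] V)ˣ).val v)) _
    rw [mul_inv_rev]
    rfl

theorem smul_form (g : (V →L[ℝ] V)ˣ) (γ : ScalarProduct p q V) (v w : V) :
    (g • γ).form v w = γ.form ((g⁻¹ : (V →L[ℝ] V)ˣ).val v) ((g⁻¹ : (V →L[ℝ] V)ˣ).val w) := rfl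

theorem continuous_form_apply (v w : V) :
    Continuous fun γ : ScalarProduct p q V => γ.form v w :=
  (continuous_apply w).comp ((continuous_apply v).comp
    (continuous_induced_dom (f := fun (γ : ScalarProduct p q V) (v w : V) => γ.form v w)))

theorem form_eq_sum {κ : Type*} [Fintype κ] (b : Module.Basis κ ℝ V) (γ : ScalarProduct p q V)
    (v w : V) : γ.form v w = ∑ i, ∑ j, b.repr v i * (b.repr w j * γ.form (b i) (b j)) := by
  conv_lhs => rw [← b.sum_repr v, ← b.sum_repr w]
  simp only [map_sum, map_smul, LinearMap.sum_apply, LinearMap.smul_apply, smul_eq_mul,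
    Finset.mul_sum]
  rw [Finset.sum_comm]
  exact Finset.sum_congr rfl fun i _ => Finset.sum_congr rfl fun j _ => mul_left_comm _ _ _

variable [FiniteDimensional ℝ V]

/-- Every value $\gamma(v,w)$ is a finite linear combination of coordinates with coefficients
independent of $\gamma$, so finitely many evaluations already generate the topology. This gives
second countability. -/
theorem isInducing_coordinates {κ : Type*} [Fintype κ] (b : Module.Basis κ ℝ V) :
    Topology.IsInducing fun (γ : ScalarProduct p q V) (i j : κ) => γ.form (b i) (b j) := by
  refine ⟨le_antisymm ?_ ?_⟩
  · exact continuous_iff_le_induced.1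
      (continuous_pi fun i => continuous_pi fun j => continuous_form_apply _ _)
  · refine continuous_iff_le_induced.1 ?_
    let : TopologicalSpace (ScalarProduct p q V) := .induced
      (fun (γ : ScalarProduct p q V) (i j : κ) => γ.form (b i) (b j)) inferInstance
    refine continuous_pi fun v => continuous_pi fun w => ?_
    simp_rw [form_eq_sum b _ v w]
    refine continuous_finsetSum _ fun i _ => continuous_finsetSum _ fun j _ => ?_
    refine continuous_const.mul (continuous_const.mul ?_)
    exact (continuous_apply j).comp ((continuous_apply i).comp (continuous_induced_dom
      (f := fun (γ : ScalarProduct p q V) (i j : κ) => γ.form (b i) (b j))))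

instance : SecondCountableTopology (ScalarProduct p q V) :=
  (isInducing_coordinates (Module.finBasis ℝ V)).secondCountableTopology

/-- In a basis, $\gamma(g^{-1}v,g^{-1}w)$ is a finite sum of products of coordinates of $g^{-1}v$,
of $g^{-1}w$ and of $\gamma$, and inversion is continuous on the units. -/
instance : ContinuousSMul (V →L[ℝ] V)ˣ (ScalarProduct p q V) where
  continuous_smul := by
    refine continuous_induced_rng.2 (continuous_pi fun v => continuous_pi fun w => ?_)
    let b := Module.finBasis ℝ V
    have hb : ∀ (v : V) i, Continuous fun z : (V →L[ℝ] V)ˣ × ScalarProduct p q V =>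
        b.repr ((z.1⁻¹ : (V →L[ℝ] V)ˣ).val v) i := by
      intro v i
      have h1 : Continuous fun u : V => b.repr u i :=
        LinearMap.continuous_of_finiteDimensional (b.coord i)
      have h2 : Continuous fun z : (V →L[ℝ] V)ˣ × ScalarProduct p q V =>
          (z.1⁻¹ : (V →L[ℝ] V)ˣ).val v :=
        (Units.continuous_val.comp continuous_fst.inv).clm_apply continuous_const
      exact h1.comp h2
    change Continuous fun z : (V →L[ℝ] V)ˣ × ScalarProduct p q V => (z.1 • z.2).form v w
    refine Continuous.congr ?_ fun z => ((smul_form _ _ v w).trans (form_eq_sum b z.2 _ _)).symm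
    exact continuous_finsetSum _ fun i _ => continuous_finsetSum _ fun j _ =>
      (hb v i).mul ((hb w j).mul ((continuous_form_apply _ _).comp continuous_snd))

/-- Equal signature gives pseudo-orthonormal bases of the two forms with the same index set; the
operator matching these bases carries one form to the other. -/
instance : MulAction.IsPretransitive (V →L[ℝ] V)ˣ (ScalarProduct p q V) where
  exists_smul_eq γ γ' := by
    obtain ⟨b, h1, h2, h3⟩ := γ.signature'
    obtain ⟨b', h1', h2', h3'⟩ := γ'.signature'
    let e : V ≃L[ℝ] V := (b.equiv b' (Equiv.refl _)).toContinuousLinearEquiv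
    refine ⟨(ContinuousLinearEquiv.unitsEquiv ℝ V).symm e, ?_⟩
    have he : ∀ i, e.symm (b' i) = b i := fun i => by
      rw [ContinuousLinearEquiv.symm_apply_eq]
      exact (b.equiv_apply i b' (Equiv.refl _)).symm
    refine ScalarProduct.ext (b'.ext fun i => b'.ext fun j => ?_)
    change γ.form (e.symm (b' i)) (e.symm (b' j)) = _
    rw [he, he]
    by_cases hij : i = j
    · subst hij
      rcases i with i | i
      · rw [h2, h2']
      · rw [h3, h3']
    · rw [h1 i j hij, h1' i j hij]

theorem secondCountableTopology_units : SecondCountableTopology (V →L[ℝ] V)ˣ :=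
  have : ProperSpace (V →L[ℝ] V) := FiniteDimensional.proper ℝ _
  have : CompleteSpace V := FiniteDimensional.complete ℝ V
  Units.isOpenEmbedding_val.isInducing.secondCountableTopology

theorem locallyCompactSpace_units : LocallyCompactSpace (V →L[ℝ] V)ˣ :=
  have : ProperSpace (V →L[ℝ] V) := FiniteDimensional.proper ℝ _
  inferInstance

/-- The measurable structure on units is the one induced from the operators; it is Borel because the
topology is induced as well. -/
theorem borelSpace_units : BorelSpace (V →L[ℝ] V)ˣ := by
  have : CompleteSpace V := FiniteDimensional.complete ℝ V
  constructor
  rw [Units.isOpenEmbedding_val.isInducing.eq_induced, borel_comap]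
  change MeasurableSpace.comap _ _ = _
  rw [BorelSpace.measurable_eq (α := V →L[ℝ] V)]

/-- A non-empty space of scalar products is a single orbit, hence a continuous image of the
σ-compact general linear group. Regular measures on it are therefore σ-finite, as Fubini requires.
-/
instance : SigmaCompactSpace (ScalarProduct p q V) := by
  rcases isEmpty_or_nonempty (ScalarProduct p q V) with _ | ⟨⟨γ⟩⟩
  · infer_instance
  · have := secondCountableTopology_units (V := V)
    have := locallyCompactSpace_units (V := V)
    refine isSigmaCompact_univ_iff.1 ?_
    rw [← (MulAction.surjective_smul (V →L[ℝ] V)ˣ γ).range_eq]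
    exact isSigmaCompact_range (by fun_prop)

theorem exists_eq_smul_of_isInvariant (μ ν : Measure (ScalarProduct p q V)) [μ.Regular] [ν.Regular]
    (hμ : IsInvariant μ) (hν : IsInvariant ν) (hμ0 : μ ≠ 0) (hν0 : ν ≠ 0) :
    ∃ c : ℝ, 0 < c ∧ ν = ENNReal.ofReal c • μ := by
  have := secondCountableTopology_units (V := V)
  have := locallyCompactSpace_units (V := V)
  have := borelSpace_units (V := V)
  -- Push-forward invariance under all linear automorphisms is translated into invariance under the
  -- action of the group of units, which carries a topology and a Haar measure.
  have inv : ∀ κ : Measure (ScalarProduct p q V), IsInvariant κ →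
      SMulInvariantMeasure (V →L[ℝ] V)ˣ _ κ := fun κ h => ⟨fun g s hs => by
    conv_rhs => rw [← h (ContinuousLinearEquiv.unitsEquiv ℝ V g).toLinearEquiv]
    rw [Measure.map_apply (pullback _).measurable hs]
    rfl⟩
  have := inv μ hμ
  have := inv ν hν
  exact exists_smul_eq_of_invariant (G := (V →L[ℝ] V)ˣ) Measure.haar μ ν hμ0 hν0

end Action

end ScalarProduct


/-! ### Tensor products of Hilbert space isomorphisms. -/

section TensorMap

namespace AlgTensor

variable {ι : Type*} [Fintype ι] {E F : ι → Type*}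
  [∀ i, NormedAddCommGroup (E i)] [∀ i, InnerProductSpace ℂ (E i)]
  [∀ i, NormedAddCommGroup (F i)] [∀ i, InnerProductSpace ℂ (F i)]

/-- The tensor product of a family of isometries, on the algebraic tensor products. -/
def map (V : ∀ i, E i →ₗᵢ[ℂ] F i) : AlgTensor E →ₗ[ℂ] AlgTensor F :=
  PiTensorProduct.map fun i => (V i).toLinearMap

theorem map_tprod (V : ∀ i, E i →ₗᵢ[ℂ] F i) (f : ∀ i, E i) :
    map V (tprod f) = tprod fun i => V i (f i) :=
  PiTensorProduct.map_tprod _ _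

theorem inner_map (V : ∀ i, E i →ₗᵢ[ℂ] F i) (x y : AlgTensor E) :
    inner ℂ (map V x) (map V y) = inner ℂ x y := by
  have span : ∀ z : AlgTensor E, z ∈ Submodule.span ℂ (Set.range (tprod (E := E))) :=
    fun z => by rw [span_tprod]; trivial
  induction span x using Submodule.span_induction with
  | mem x hx =>
    obtain ⟨f, rfl⟩ := hx
    induction span y using Submodule.span_induction with
    | mem y hy => obtain ⟨g, rfl⟩ := hy; simp [map_tprod, inner_tprod]
    | zero => simp
    | add y z _ _ hy hz => rw [map_add, inner_add_right, inner_add_right, hy, hz]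
    | smul c y _ hy => rw [map_smul, inner_smul_right, inner_smul_right, hy]
  | zero => simp
  | add x z _ _ hx hz => rw [map_add, inner_add_left, inner_add_left, hx, hz]
  | smul c x _ hx => rw [map_smul, inner_smul_left, inner_smul_left, hx]

/-- The map `AlgTensor.map` as an isometry. -/
def mapIso (V : ∀ i, E i →ₗᵢ[ℂ] F i) : AlgTensor E →ₗᵢ[ℂ] AlgTensor F where
  toLinearMap := map V
  norm_map' x := by
    rw [@norm_eq_sqrt_re_inner ℂ, @norm_eq_sqrt_re_inner ℂ _ _ _ _ x, inner_map]

end AlgTensor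

open UniformSpace

variable {X : Type*} {E F : X → Type*}
  [∀ x, NormedAddCommGroup (E x)] [∀ x, InnerProductSpace ℂ (E x)]
  [∀ x, NormedAddCommGroup (F x)] [∀ x, InnerProductSpace ℂ (F x)]

/-- The tensor product of a family of isometries, as a bounded operator. -/
def tensorMapL (V : ∀ x, E x →ₗᵢ[ℂ] F x) (s : Finset X) : TSpace E s →L[ℂ] TSpace F s :=
  (AlgTensor.mapIso fun x : s => V x).toContinuousLinearMap.completion

theorem tensorMapL_elem (V : ∀ x, E x →ₗᵢ[ℂ] F x) (s : Finset X) (f : ∀ x, E x) :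
    tensorMapL V s (elem s f) = elem s fun x => V x (f x) := by
  rw [tensorMapL, elem, ContinuousLinearMap.completion_apply_coe, elem]
  exact congrArg _ (AlgTensor.map_tprod _ _)

theorem norm_tensorMapL (V : ∀ x, E x →ₗᵢ[ℂ] F x) (s : Finset X) (Ψ : TSpace E s) :
    ‖tensorMapL V s Ψ‖ = ‖Ψ‖ := by
  induction Ψ using Completion.induction_on with
  | hp => exact isClosed_eq (tensorMapL V s).continuous.norm continuous_norm
  | ih x =>
    rw [tensorMapL, ContinuousLinearMap.completion_apply_coe, Completion.norm_coe,
      Completion.norm_coe]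
    exact (AlgTensor.mapIso fun x : s => V x).norm_map x

/-- The tensor product of a family of isometries. -/
def tensorIso (V : ∀ x, E x →ₗᵢ[ℂ] F x) (s : Finset X) : TSpace E s →ₗᵢ[ℂ] TSpace F s where
  toLinearMap := (tensorMapL V s).toLinearMap
  norm_map' Ψ := norm_tensorMapL V s Ψ

theorem tensorMapL_symm_apply (V : ∀ x, E x ≃ₗᵢ[ℂ] F x) (s : Finset X) (Ψ : TSpace F s) :
    tensorMapL (fun x => (V x).toLinearIsometry) s
      (tensorMapL (fun x => (V x).symm.toLinearIsometry) s Ψ) = Ψ := by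
  have h : tensorMapL (fun x => (V x).toLinearIsometry) s ∘L
      tensorMapL (fun x => (V x).symm.toLinearIsometry) s = ContinuousLinearMap.id ℂ _ :=
    ext_elem fun f => by
      rw [ContinuousLinearMap.comp_apply, tensorMapL_elem, tensorMapL_elem,
        ContinuousLinearMap.id_apply]
      exact elem_congr fun x _ => (V x).apply_symm_apply (f x)
  exact DFunLike.congr_fun h Ψ

theorem tensorIso_surjective (V : ∀ x, E x ≃ₗᵢ[ℂ] F x) (s : Finset X) :
    Function.Surjective (tensorIso (fun x => (V x).toLinearIsometry) s) :=
  fun Ψ => ⟨_, tensorMapL_symm_apply V s Ψ⟩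

/-- The tensor product of a family of Hilbert space isomorphisms. -/
def tensorEquiv (V : ∀ x, E x ≃ₗᵢ[ℂ] F x) (s : Finset X) : TSpace E s ≃ₗᵢ[ℂ] TSpace F s :=
  LinearIsometryEquiv.ofSurjective (tensorIso (fun x => (V x).toLinearIsometry) s)
    (tensorIso_surjective V s)

theorem tensorEquiv_elem (V : ∀ x, E x ≃ₗᵢ[ℂ] F x) (s : Finset X) (f : ∀ x, E x) :
    tensorEquiv V s (elem s f) = elem s fun x => V x (f x) := by
  rw [tensorEquiv, LinearIsometryEquiv.coe_ofSurjective]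
  exact tensorMapL_elem (fun x => (V x).toLinearIsometry) s f

/-- Elementary tensors span a dense subspace; this is the source of the uniqueness of the family
$U_\lambda$. -/
theorem eq_tensorEquiv {V : ∀ x, E x ≃ₗᵢ[ℂ] F x} {s : Finset X}
    {U : TSpace E s ≃ₗᵢ[ℂ] TSpace F s} (h : ∀ f, U (elem s f) = elem s fun x => V x (f x)) :
    U = tensorEquiv V s := by
  have : U.toContinuousLinearEquiv.toContinuousLinearMap =
      (tensorEquiv V s).toContinuousLinearEquiv.toContinuousLinearMap :=
    ext_elem fun f => (h f).trans (tensorEquiv_elem V s f).symm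
  ext Ψ
  exact DFunLike.congr_fun this Ψ

/-- Both sides are bounded operators, and on an elementary tensor `Phi` only groups the factors,
while the isomorphism acts on each factor separately. -/
theorem isTensorCompatible_tensorEquiv (V : ∀ x, E x ≃ₗᵢ[ℂ] F x) :
    IsTensorCompatible (tensorEquiv V) := by
  classical
  intro s t h Ψ
  have : (Phi h).toContinuousLinearEquiv.toContinuousLinearMap ∘L
      (tensorEquiv V t).toContinuousLinearEquiv.toContinuousLinearMap =
      HTensor.map (tensorEquiv V (t \ s)).toContinuousLinearEquiv.toContinuousLinearMap
        (tensorEquiv V s).toContinuousLinearEquiv.toContinuousLinearMap ∘L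
          (Phi h).toContinuousLinearEquiv.toContinuousLinearMap := by
    refine ext_elem fun f => ?_
    change Phi h (tensorEquiv V t (elem t f)) = HTensor.map _ _ (Phi h (elem t f))
    rw [tensorEquiv_elem, Phi_elem, Phi_elem, HTensor.map,
      ContinuousLinearMap.completion_apply_coe]
    change _ = ((tensorEquiv V (t \ s) (elem (t \ s) f) ⊗ₜ[ℂ] tensorEquiv V s (elem s f) :
      TSpace F (t \ s) ⊗[ℂ] TSpace F s) : HTensor (TSpace F (t \ s)) (TSpace F s))
    rw [tensorEquiv_elem, tensorEquiv_elem]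
  exact DFunLike.congr_fun this Ψ

theorem tensorEquiv_tensorLeft (V : ∀ x, E x ≃ₗᵢ[ℂ] F x) {s t : Finset X} (h : s ⊆ t)
    (f : ∀ x, E x) (b : TSpace E s) :
    tensorEquiv V t (tensorLeft h f b) = tensorLeft h (fun x => V x (f x)) (tensorEquiv V s b) := by
  classical
  have : (tensorEquiv V t).toContinuousLinearEquiv.toContinuousLinearMap ∘L tensorLeft h f =
      tensorLeft h (fun x => V x (f x)) ∘L
        (tensorEquiv V s).toContinuousLinearEquiv.toContinuousLinearMap := by
    refine ext_elem fun g => ?_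
    change tensorEquiv V t (tensorLeft h f (elem s g)) = tensorLeft h _ (tensorEquiv V s (elem s g))
    rw [tensorLeft_elem, tensorEquiv_elem, tensorEquiv_elem, tensorLeft_elem]
    refine elem_congr fun x _ => ?_
    by_cases hx : x ∈ s <;> simp [hx]
  exact DFunLike.congr_fun this b

/-- An amplified operator is determined by its action $e\otimes b\mapsto e\otimes ab$ with $e$
elementary. Conjugation by the tensor isomorphisms turns this into the same rule with $a$ replaced
by its conjugate, by `tensorEquiv_tensorLeft`. -/
theorem intertwinesFamilies_tensorEquiv (V : ∀ x, E x ≃ₗᵢ[ℂ] F x) :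
    IntertwinesFamilies (tensorEquiv V) := by
  intro s t h a
  refine amplify_eq h fun f b => ?_
  -- Surjectivity of the isomorphisms allows both tensor factors to be written as images, so that
  -- the inverse of the tensor isomorphism can be evaluated.
  obtain ⟨f, rfl⟩ : ∃ f', (fun x => V x (f' x)) = f := ⟨fun x => (V x).symm (f x), by simp⟩
  obtain ⟨b, rfl⟩ := (tensorEquiv V s).surjective b
  change tensorEquiv V t (amplify h a ((tensorEquiv V t).symm _)) =
    tensorLeft h _ (tensorEquiv V s (a ((tensorEquiv V s).symm _)))
  rw [← tensorEquiv_tensorLeft, LinearIsometryEquiv.symm_apply_apply,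
    LinearIsometryEquiv.symm_apply_apply, amplify_tensorLeft, tensorEquiv_tensorLeft]

/-- Multilinearity extracts one scalar per point of `s`; with $r=c^{-1/2}$ this produces the factor
$c^{-\#\lambda/2}$. -/
theorem elem_smul (r : ℂ) (s : Finset X) (f : ∀ x, E x) :
    elem s (fun x => r • f x) = r ^ s.card • elem s f := by
  rw [elem, elem, ← Completion.coe_smul]
  refine congrArg _ (((PiTensorProduct.tprod ℂ).map_smul_univ (fun _ : s => r)
    fun x : s => f x).trans ?_)
  simp
  rfl

end TensorMap

/-! ### Functoriality of inductive limits of C*-algebras and of projective limits of state spaces.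
-/

section Limits

open UniformSpace

variable {Λ : Type*} [Preorder Λ] [IsDirectedOrder Λ] [Nonempty Λ] {A B : Λ → Type*}
  [∀ i, CStarAlgebra (A i)] [∀ i, CStarAlgebra (B i)]
  {f : ∀ i j, i ≤ j → A i →⋆ₐ[ℂ] A j} {f' : ∀ i j, i ≤ j → B i →⋆ₐ[ℂ] B j}

theorem map_symm_of_intertwines (u : ∀ i, A i ≃⋆ₐ[ℂ] B i)
    (hu : ∀ i j h a, f' i j h (u i a) = u j (f i j h a)) (i j : Λ) (h : i ≤ j) (b : B i) :
    f i j h ((u i).symm b) = (u j).symm (f' i j h b) := by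
  refine EquivLike.injective (u j) ?_
  rw [← hu, StarAlgEquiv.apply_symm_apply, StarAlgEquiv.apply_symm_apply]

section CStar

variable [DirectedSystem A (f · · ·)] {hf : ∀ i j h, Function.Injective (f i j h)}
  [DirectedSystem B (f' · · ·)] {hf' : ∀ i j h, Function.Injective (f' i j h)}

/-- The images of the members of the family have dense union. The uniqueness of $\mathcal U$ and the
duality formula for states both reduce to this. -/
theorem CStarLimit.funext_of {P : Type*} [TopologicalSpace P] [T2Space P]
    {g g' : CStarLimit f hf → P} (hg : Continuous g) (hg' : Continuous g')
    (h : ∀ i a, g (CStarLimit.of f hf i a) = g' (CStarLimit.of f hf i a)) : g = g' := by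
  funext x
  induction x using CStarLimit.induction f with
  | hp => exact isClosed_eq hg hg'
  | h x => obtain ⟨i, a, rfl⟩ := AlgLimit.exists_mk f x; exact h i a

variable {C : Type*} [CStarAlgebra C] (φ : ∀ i, A i →⋆ₐ[ℂ] C)
  (hφ : ∀ i j h a, φ j (f i j h a) = φ i a)

variable (hf) in
/-- The bounded operator on the algebraic inductive limit which is given by a compatible family
of `*`-homomorphisms. -/
def AlgLimit.liftL : AlgLimit f hf →L[ℂ] C :=
  LinearMap.mkContinuous
    { toFun := fun x => DirectLimit.lift f (fun i a => φ i a)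
        (fun i j h a => (hφ i j h a).symm) x
      map_add' := fun x y => by
        obtain ⟨i, a, b, rfl, rfl⟩ := AlgLimit.exists_mk₂ f x y
        rw [← AlgLimit.mk_add]
        exact map_add (φ i) a b
      map_smul' := fun c x => by
        obtain ⟨i, a, rfl⟩ := AlgLimit.exists_mk f x
        rw [← AlgLimit.mk_smul]
        exact map_smul (φ i) c a } 1
    fun x => by
      obtain ⟨i, a, rfl⟩ := AlgLimit.exists_mk f x
      rw [one_mul]
      -- Homomorphisms of C*-algebras are contractive, so the bound 1 is uniform in `i` and the map
      -- extends to the completion.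
      exact NonUnitalStarAlgHom.norm_apply_le (φ i) a

variable (hf) in
/-- The bounded operator on the inductive limit which is given by a compatible family of
`*`-homomorphisms. -/
def CStarLimit.liftL : CStarLimit f hf →L[ℂ] C := (AlgLimit.liftL hf φ hφ).fromCompletion

theorem CStarLimit.liftL_of (i : Λ) (a : A i) :
    liftL hf φ hφ (of f hf i a) = φ i a :=
  ContinuousLinearMap.fromCompletion_apply_coe _ _

variable (hf) in
/-- The universal property of the inductive limit C*-algebra. -/
def CStarLimit.lift : CStarLimit f hf →⋆ₐ[ℂ] C where
  toFun := liftL hf φ hφ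
  map_zero' := map_zero _
  map_add' := map_add _
  map_one' := by
    obtain ⟨i⟩ := ‹Nonempty Λ›
    rw [← map_one (of f hf i), liftL_of, map_one]
  map_mul' x y := by
    induction x, y using CStarLimit.induction₂ f with
    | hp =>
      exact isClosed_eq ((liftL hf φ hφ).continuous.comp continuous_mul)
        (((liftL hf φ hφ).continuous.comp continuous_fst).mul
          ((liftL hf φ hφ).continuous.comp continuous_snd))
    | h x y =>
      obtain ⟨i, a, b, rfl, rfl⟩ := AlgLimit.exists_mk₂ f x y
      change liftL hf φ hφ (of f hf i a * of f hf i b) =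
        liftL hf φ hφ (of f hf i a) * liftL hf φ hφ (of f hf i b)
      rw [← map_mul, liftL_of, liftL_of, liftL_of, map_mul]
  commutes' c := by
    obtain ⟨i⟩ := ‹Nonempty Λ›
    rw [← AlgHomClass.commutes (of f hf i), liftL_of, AlgHomClass.commutes]
  map_star' x := by
    induction x using CStarLimit.induction f with
    | hp =>
      exact isClosed_eq ((liftL hf φ hφ).continuous.comp continuous_star)
        (continuous_star.comp (liftL hf φ hφ).continuous)
    | h x =>
      obtain ⟨i, a, rfl⟩ := AlgLimit.exists_mk f x
      change liftL hf φ hφ (star (of f hf i a)) = star (liftL hf φ hφ (of f hf i a))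
      rw [← map_star, liftL_of, liftL_of, map_star]

theorem CStarLimit.lift_of (i : Λ) (a : A i) : lift hf φ hφ (of f hf i a) = φ i a :=
  liftL_of φ hφ i a

theorem CStarLimit.continuous_lift : Continuous (lift hf φ hφ) :=
  (liftL hf φ hφ).continuous

variable (hf hf') in
/-- The isomorphism of inductive limits which is induced by isomorphisms of the members of two
inductive families. -/
def CStarLimit.congr (u : ∀ i, A i ≃⋆ₐ[ℂ] B i)
    (hu : ∀ i j h a, f' i j h (u i a) = u j (f i j h a)) : CStarLimit f hf ≃⋆ₐ[ℂ] CStarLimit f' hf' :=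
  let a := lift hf (fun i => (of f' hf' i).comp (u i).toStarAlgHom)
    fun i j h a => by
      change of f' hf' j (u j (f i j h a)) = of f' hf' i (u i a)
      rw [← hu, of_map]
  let b := lift hf' (fun i => (of f hf i).comp (u i).symm.toStarAlgHom)
    fun i j h a => by
      change of f hf j ((u j).symm (f' i j h a)) = of f hf i ((u i).symm a)
      rw [← map_symm_of_intertwines u hu, of_map]
  StarAlgEquiv.ofStarAlgHom a b
    (DFunLike.coe_injective <| funext_of ((continuous_lift _ _).comp (continuous_lift _ _))
      continuous_id fun i x => by
        change b (a (of f hf i x)) = of f hf i x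
        rw [lift_of]
        refine (lift_of _ _ i (u i x)).trans ?_
        exact congrArg (of f hf i) ((u i).symm_apply_apply x))
    (DFunLike.coe_injective <| funext_of ((continuous_lift _ _).comp (continuous_lift _ _))
      continuous_id fun i x => by
        change a (b (of f' hf' i x)) = of f' hf' i x
        rw [lift_of]
        refine (lift_of _ _ i ((u i).symm x)).trans ?_
        exact congrArg (of f' hf' i) ((u i).apply_symm_apply x))

theorem CStarLimit.congr_of (u : ∀ i, A i ≃⋆ₐ[ℂ] B i)
    (hu : ∀ i j h a, f' i j h (u i a) = u j (f i j h a)) (i : Λ) (a : A i) :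
    congr hf hf' u hu (of f hf i a) = of f' hf' i (u i a) :=
  lift_of _ _ i a

/-- Continuity is automatic by contractivity, so uniqueness holds among all $*$-isomorphisms. -/
theorem CStarLimit.continuous_starAlgEquiv (𝒰 : CStarLimit f hf ≃⋆ₐ[ℂ] CStarLimit f' hf') :
    Continuous 𝒰 :=
  AddMonoidHomClass.continuous_of_bound 𝒰 1 fun b =>
    (NonUnitalStarAlgHom.norm_apply_le 𝒰 b).trans_eq (one_mul _).symm

theorem CStarLimit.starAlgEquiv_ext {𝒰 𝒰' : CStarLimit f hf ≃⋆ₐ[ℂ] CStarLimit f' hf'}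
    (h : ∀ i a, 𝒰 (of f hf i a) = 𝒰' (of f hf i a)) : 𝒰 = 𝒰' :=
  DFunLike.coe_injective <| funext_of (continuous_starAlgEquiv 𝒰) (continuous_starAlgEquiv 𝒰') h

theorem ProjStates.toState_eq_toState_apply {u : ∀ i, A i → B i}
    {𝒰 : CStarLimit f hf ≃⋆ₐ[ℂ] CStarLimit f' hf'}
    (h𝒰 : ∀ i a, 𝒰 (CStarLimit.of f hf i a) = CStarLimit.of f' hf' i (u i a))
    {σ : ProjStates f'} {τ : ProjStates f} (h : ∀ i a, τ.proj f i a = σ.proj f' i (u i a))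
    (b : CStarLimit f hf) : τ.toState f hf b = σ.toState f' hf' (𝒰 b) := by
  refine congrFun (CStarLimit.funext_of (g := fun b => τ.toState f hf b)
    (g' := fun b => σ.toState f' hf' (𝒰 b)) (τ.toState f hf).toCLM.continuous
    ((σ.toState f' hf').toCLM.continuous.comp (CStarLimit.continuous_starAlgEquiv 𝒰))
    fun i a => ?_) b
  rw [toState_of, h𝒰, toState_of, h]

end CStar

/-- Evaluating a pulled-back state at `a` is evaluating the original one at `g a`, which is weak-*
continuous. -/
theorem State.continuous_comap {A B : Type*} [CStarAlgebra A] [CStarAlgebra B] (g : A →⋆ₐ[ℂ] B) :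
    Continuous (State.comap g) :=
  continuous_induced_rng.2 <| continuous_pi fun a => (continuous_apply (g a)).comp
    (continuous_induced_dom (f := fun (φ : State B) (b : B) => φ b))

/-- The pull-back of projective families of states along a morphism of inductive families. -/
def ProjStates.comap (u : ∀ i, A i →⋆ₐ[ℂ] B i)
    (hu : ∀ i j h a, f' i j h (u i a) = u j (f i j h a)) (s : ProjStates f') : ProjStates f :=
  ⟨fun i => State.comap (u i) (s.1 i), fun i j h => DFunLike.ext _ _ fun a => by
    rw [State.comap_apply, State.comap_apply, State.comap_apply, ← hu]
    exact DFunLike.congr_fun (s.2 i j h) (u i a)⟩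

theorem ProjStates.continuous_comap (u : ∀ i, A i →⋆ₐ[ℂ] B i)
    (hu : ∀ i j h a, f' i j h (u i a) = u j (f i j h a)) : Continuous (ProjStates.comap u hu) :=
  Continuous.subtype_mk (continuous_pi fun i => (State.continuous_comap (u i)).comp
    ((continuous_apply i).comp continuous_subtype_val)) _

/-- The homeomorphism of projective limits which is induced by isomorphisms of the members of two
inductive families. -/
def ProjStates.congr (u : ∀ i, A i ≃⋆ₐ[ℂ] B i)
    (hu : ∀ i j h a, f' i j h (u i a) = u j (f i j h a)) : ProjStates f' ≃ₜ ProjStates f where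
  toFun := ProjStates.comap (fun i => (u i).toStarAlgHom) hu
  invFun := ProjStates.comap (fun i => (u i).symm.toStarAlgHom) (map_symm_of_intertwines u hu)
  left_inv s := Subtype.ext <| funext fun i => DFunLike.ext _ _ fun a =>
    congrArg (s.1 i) ((u i).apply_symm_apply a)
  right_inv s := Subtype.ext <| funext fun i => DFunLike.ext _ _ fun a =>
    congrArg (s.1 i) ((u i).symm_apply_apply a)
  continuous_toFun := ProjStates.continuous_comap _ _
  continuous_invFun := ProjStates.continuous_comap _ _

end Limits

/-! ### The rescaling isomorphism between the $L^2$ spaces of proportional measures. -/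

section Rescaling

open MeasureTheory

variable {Y : Type*} [MeasurableSpace Y] {μ ν : Measure Y} {c : ℝ}

theorem memLp_rescale (h : ν = ENNReal.ofReal c • μ) (f : Lp ℂ 2 μ) : MemLp f 2 ν :=
  h ▸ (Lp.memLp f).smul_measure ENNReal.ofReal_ne_top

theorem measure_eq_inv_smul (hc : 0 < c) (h : ν = ENNReal.ofReal c • μ) :
    μ = ENNReal.ofReal c⁻¹ • ν := by
  rw [h, smul_smul, ← ENNReal.ofReal_mul (inv_nonneg.2 hc.le), inv_mul_cancel₀ hc.ne',
    ENNReal.ofReal_one, one_smul]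

theorem ae_le_of_smul_eq (h : ν = ENNReal.ofReal c • μ) : ae ν ≤ ae μ :=
  h ▸ Measure.ae_smul_measure_le _

/-- The isometry `f ↦ f / √c` from `L²(μ)` to `L²(c μ)`. -/
def rescaleIso (hc : 0 < c) (h : ν = ENNReal.ofReal c • μ) : Lp ℂ 2 μ →ₗᵢ[ℂ] Lp ℂ 2 ν where
  toFun f := ((1 / √c : ℝ) : ℂ) • (memLp_rescale h f).toLp f
  map_add' f g := by
    rw [← smul_add, ← MemLp.toLp_add]
    congr 1
    exact MemLp.toLp_congr _ _ (ae_le_of_smul_eq h (Lp.coeFn_add f g))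
  map_smul' r f := by
    rw [RingHom.id_apply, smul_comm]
    congr 1
    exact (MemLp.toLp_congr _ ((memLp_rescale h f).const_smul r)
      (ae_le_of_smul_eq h (Lp.coeFn_smul r f))).trans (MemLp.toLp_const_smul _ _)
  norm_map' f := by
    have hs : 0 < √c := Real.sqrt_pos.2 hc
    -- Scaling the measure by $c$ scales the $L^2$ norm by $c^{1/2}$; the factor $1/\sqrt c$ in the
    -- map cancels it.
    have h1 : ‖(memLp_rescale h f).toLp f‖ = √c * ‖f‖ := by
      rw [Lp.norm_toLp, Lp.norm_def]
      conv_lhs => rw [h]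
      rw [eLpNorm_smul_measure_of_ne_top (by norm_num), smul_eq_mul, ENNReal.toReal_mul,
        ← ENNReal.toReal_rpow, ENNReal.toReal_ofReal hc.le, Real.sqrt_eq_rpow]
      norm_num
    change ‖((1 / √c : ℝ) : ℂ) • (memLp_rescale h f).toLp f‖ = ‖f‖
    rw [norm_smul, h1, Complex.norm_real, Real.norm_of_nonneg (by positivity)]
    field_simp

/-- One function has different classes `f` and `g` in the two $L^2$ spaces. This form allows any
pair of classes with almost everywhere equal representatives, as `IsRescaling` does. -/
theorem rescaleIso_eq (hc : 0 < c) (h : ν = ENNReal.ofReal c • μ) {f : Lp ℂ 2 μ} {g : Lp ℂ 2 ν}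
    (hfg : f =ᵐ[μ] g) : rescaleIso hc h f = ((1 / √c : ℝ) : ℂ) • g := by
  change ((1 / √c : ℝ) : ℂ) • (memLp_rescale h f).toLp f = _
  rw [MemLp.toLp_congr _ (Lp.memLp g) (ae_le_of_smul_eq h hfg), Lp.toLp_coeFn]

/-- The Hilbert space isomorphism `f ↦ f / √c` from `L²(μ)` to `L²(c μ)`. -/
def rescaleEquiv (hc : 0 < c) (h : ν = ENNReal.ofReal c • μ) : Lp ℂ 2 μ ≃ₗᵢ[ℂ] Lp ℂ 2 ν :=
  LinearIsometryEquiv.ofSurjective (rescaleIso hc h) fun g => by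
    have h' := measure_eq_inv_smul hc h
    -- The preimage is $\sqrt c\,g$, where $g$ is read as an element of $L^2(\mu)$ through
    -- $\mu=c^{-1}\nu$.
    refine ⟨((√c : ℝ) : ℂ) • (memLp_rescale h' g).toLp g, ?_⟩
    rw [map_smul, rescaleIso_eq hc h (g := g) (MemLp.coeFn_toLp _), smul_smul,
      ← Complex.ofReal_mul, mul_one_div_cancel (Real.sqrt_pos.2 hc).ne', Complex.ofReal_one,
      one_smul]

theorem rescaleEquiv_eq (hc : 0 < c) (h : ν = ENNReal.ofReal c • μ) {f : Lp ℂ 2 μ}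
    {g : Lp ℂ 2 ν} (hfg : f =ᵐ[μ] g) : rescaleEquiv hc h f = ((1 / √c : ℝ) : ℂ) • g :=
  rescaleIso_eq hc h hfg

end Rescaling

/-! ### Invariant measure fields and their rescaling families. -/

section Fields

open MeasureTheory

variable {n p q : ℕ} {M : Type*} [TopologicalSpace M]
  [ChartedSpace (EuclideanSpace ℝ (Fin n)) M]

/-- Every tangent space is by definition the model space, so the isomorphism `l` is itself an
element of the general linear group, and pushing forward along it does not change the invariant
measure. The base point shows that the manifold is non-empty, which is needed for the uniqueness of
$c$. -/
theorem InvariantMeasureField.exists_measure_eq (μ : InvariantMeasureField n p q M) :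
    Nonempty M ∧ ∃ μ₀ : Measure (ScalarProduct p q (EuclideanSpace ℝ (Fin n))),
      μ₀.Regular ∧ μ₀ ≠ 0 ∧ ScalarProduct.IsInvariant μ₀ ∧ ∀ x, μ.measure x = μ₀ := by
  obtain ⟨x₀, μ₀, hr, h0, hi, h⟩ := μ.exists_eq'
  refine ⟨⟨x₀⟩, μ₀, hr, h0, hi, fun x => ?_⟩
  obtain ⟨l, hl⟩ := h x
  rw [hl]
  exact hi (LinearEquiv.symm (M := EuclideanSpace ℝ (Fin n)) (M₂ := EuclideanSpace ℝ (Fin n)) l)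

theorem InvariantMeasureField.existsUnique_smul_eq (μ ν : InvariantMeasureField n p q M) :
    ∃! c : ℝ, 0 < c ∧ ∀ x, ν.measure x = ENNReal.ofReal c • μ.measure x := by
  obtain ⟨⟨x₀⟩, μ₀, _, hμ0, hμi, hμ⟩ := μ.exists_measure_eq
  obtain ⟨-, ν₀, _, hν0, hνi, hν⟩ := ν.exists_measure_eq
  obtain ⟨c, hc, h⟩ := ScalarProduct.exists_eq_smul_of_isInvariant μ₀ ν₀ hμi hνi hμ0 hν0
  refine ⟨c, ⟨hc, fun x => by rw [hμ, hν, h]; rfl⟩, fun d ⟨hd, hd'⟩ => ?_⟩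
  -- Inner regularity provides a compact set of positive measure, finite by compactness; comparing
  -- the two measures on it determines the constant.
  obtain ⟨K, -, hK, hpos⟩ := isOpen_univ.exists_lt_isCompact
    (show 0 < μ₀ Set.univ from pos_iff_ne_zero.2 (Measure.measure_univ_ne_zero.2 hμ0))
  have h1 : ENNReal.ofReal d * μ₀ K = ENNReal.ofReal c * μ₀ K := by
    have h2 := hd' x₀
    rw [hμ, hν, h] at h2
    exact (DFunLike.congr_fun h2 K).symm
  rw [ENNReal.mul_left_inj hpos.ne' hK.measure_lt_top.ne] at h1
  exact (ENNReal.ofReal_eq_ofReal_iff hd.le hc.le).1 h1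

variable {μ ν : InvariantMeasureField n p q M} {c : ℝ}

/-- This yields existence and uniqueness of the family at once, and reduces all further claims to
tensor products of isomorphisms. -/
theorem isRescaling_iff (hc : 0 < c) (h : ∀ x, ν.measure x = ENNReal.ofReal c • μ.measure x)
    (U : ∀ s : Finset M, TSpace μ.L2 s ≃ₗᵢ[ℂ] TSpace ν.L2 s) :
    IsRescaling c U ↔ U = tensorEquiv fun x => rescaleEquiv hc (h x) := by
  have key : ∀ (s : Finset M) (f : ∀ x, μ.L2 x) (g : ∀ x, ν.L2 x),
      (∀ x ∈ s, f x =ᵐ[μ.measure x] g x) →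
        elem s (fun x => rescaleEquiv hc (h x) (f x)) = ((1 / √c ^ s.card : ℝ) : ℂ) • elem s g := by
    intro s f g hfg
    rw [elem_congr (g := fun x => ((1 / √c : ℝ) : ℂ) • g x) fun x hx =>
      rescaleEquiv_eq hc (h x) (hfg x hx), elem_smul, ← Complex.ofReal_pow, one_div_pow]
  constructor
  · intro hU
    funext s
    refine eq_tensorEquiv fun f => ?_
    -- Every `f x` has a partner in $L^2(\nu_x)$, namely its own class there. The two agree
    -- $\nu_x$-almost everywhere, hence $\mu_x$-almost everywhere because $\mu_x=c^{-1}\nu_x$.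
    have hfg : ∀ x ∈ s, f x =ᵐ[μ.measure x] (memLp_rescale (h x) (f x)).toLp (f x) := fun x _ =>
      Filter.EventuallyEq.symm (ae_le_of_smul_eq (measure_eq_inv_smul hc (h x))
        (MemLp.coeFn_toLp (memLp_rescale (h x) (f x))))
    rw [hU s f (fun x => (memLp_rescale (h x) (f x)).toLp (f x)) hfg, key s f _ hfg]
  · rintro rfl s f g hfg
    rw [tensorEquiv_elem, key s f g hfg]

end Fields

end Kijowski

theorem mainTheorem2 (n p q : ℕ) (hn : p + q = n) (M : Type*) [TopologicalSpace M]
    [ChartedSpace (EuclideanSpace ℝ (Fin n)) M] [IsManifold (𝓡 n) ∞ M]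
    (μ ν : InvariantMeasureField n p q M) :
    (∃! c : ℝ, 0 < c ∧ ∀ x, ν.measure x = ENNReal.ofReal c • μ.measure x) ∧
    ∀ c : ℝ, 0 < c → (∀ x, ν.measure x = ENNReal.ofReal c • μ.measure x) →
      (∃! U : ∀ s : Finset M, TSpace μ.L2 s ≃ₗᵢ[ℂ] TSpace ν.L2 s, IsRescaling c U) ∧
      ∀ U : ∀ s : Finset M, TSpace μ.L2 s ≃ₗᵢ[ℂ] TSpace ν.L2 s, IsRescaling c U →
        IsTensorCompatible U ∧
        IntertwinesFamilies U ∧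
        (∃! 𝒰 : Observables μ.L2 ≃⋆ₐ[ℂ] Observables ν.L2, IsInducedOnObservables U 𝒰) ∧
        (∃! 𝒱 : QuantumStates ν.L2 ≃ₜ QuantumStates μ.L2, IsInducedOnStates U 𝒱) ∧
        ∀ (𝒰 : Observables μ.L2 ≃⋆ₐ[ℂ] Observables ν.L2)
          (𝒱 : QuantumStates ν.L2 ≃ₜ QuantumStates μ.L2),
          IsInducedOnObservables U 𝒰 → IsInducedOnStates U 𝒱 →
            (∀ (r : ℝ) (σ σ₁ σ₂ : QuantumStates ν.L2), 0 ≤ r → r ≤ 1 →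
              IsConvexCombination r σ σ₁ σ₂ →
                IsConvexCombination r (𝒱 σ) (𝒱 σ₁) (𝒱 σ₂)) ∧
            (∀ (σ : QuantumStates ν.L2) (b : Observables μ.L2),
              (𝒱 σ).toState b = σ.toState (𝒰 b)) := by
  refine ⟨μ.existsUnique_smul_eq ν, fun c hc h => ⟨⟨tensorEquiv fun x => rescaleEquiv hc (h x),
    (isRescaling_iff hc h _).2 rfl, fun U hU => (isRescaling_iff hc h U).1 hU⟩, fun U hU => ?_⟩⟩
  have hcompat : IsTensorCompatible U := by
    rw [(isRescaling_iff hc h U).1 hU]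
    exact isTensorCompatible_tensorEquiv _
  have hint : IntertwinesFamilies U := by
    rw [(isRescaling_iff hc h U).1 hU]
    exact intertwinesFamilies_tensorEquiv _
  refine ⟨hcompat, hint, ⟨CStarLimit.congr _ _ (conjObs U) hint, CStarLimit.congr_of _ hint,
    fun 𝒰 h𝒰 => CStarLimit.starAlgEquiv_ext fun s a => (h𝒰 s a).trans (CStarLimit.congr_of _ hint s a).symm⟩,
    ⟨ProjStates.congr (conjObs U) hint, fun σ s a => rfl,
      -- The condition prescribes every value of every component, so uniqueness of the map of states
      -- is pointwise and needs no density.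
      fun 𝒱 h𝒱 => Homeomorph.ext fun σ => Subtype.ext <| funext fun s =>
        DFunLike.ext _ _ fun a => h𝒱 σ s a⟩, fun 𝒰 𝒱 h𝒰 h𝒱 => ⟨?_, ?_⟩⟩
  · intro r σ σ₁ σ₂ _ _ hσ s a
    rw [h𝒱, h𝒱, h𝒱]
    exact hσ s _
  · exact fun σ b => ProjStates.toState_eq_toState_apply h𝒰 (h𝒱 σ) b

end
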